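/- **Setting.** For each sample size $n$ let $\mathbf y=\mathbf X\beta^*+\varepsilon$ with a nonstochastic $n\times p$ design $\mathbf X$ whose columns satisfy $\mathbf x_{(j)}^T\mathbf x_{(j)}/n=1$. Here $p$, $\mathbf X$, $\beta^*$, the error law, $\lambda>0$ and $\tau>0$ may depend on $n$. Let $A_0=\{j:\beta^*_j\ne0\}\neq\emptyset$, $q=|A_0|$, $d_*=\min_{j\in A_0}|\beta_j^*|$. For an index set $B$ let $\mathbf X_B$ be the submatrix of the columns in $B$ and $G_B=n^{-1}\mathbf X_B^T\mathbf X_B$; for a matrix $A$ let $\|A\|_1=\max_i\sum_j|a_{ij}|$. For real $m\ge q$ let $\xi_{\min}(m)$, $\xi_{\max}(m)$, $\zeta_{\max}(m)$, $\zeta_{\min}(m)$ be respectively the minimum of $\lambda_{\min}(G_B)$ and the maxima of $\lambda_{\max}(G_B)$, $\|G_B\|_1$, $\|G_B^{-1}\|_1$ over all $B\supseteq A_0$ with $|B|\le m$. The oracle estimator $\widehat\beta^{(o)}$ is the least squares estimator using only the covariates in $A_0$, extended by zero. Given a penalty family $p_\lambda(|t|)=J_\lambda(|t|)+\lambda|t|$,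 let $\nabla J_\lambda(|t|)$ be the derivative of $t\mapsto J_\lambda(|t|)$ and $$Q(\beta\mid\beta',\lambda)=\frac1{2n}\|\mathbf y-\mathbf X\beta\|^2+\sum_{j}\nabla J_\lambda(|\beta'_j|)\beta_j+\lambda\sum_{j}|\beta_j| .$$ A calibrated CCCP path $\{\widehat\beta(\lambda):\lambda>0\}$ (with $\tau$ fixed along the path) is given by $\widehat\beta^{(1)}(\lambda)\in\arg\min_\beta Q(\beta\mid\mathbf 0,\tau\lambda)$ and $\widehat\beta(\lambda)\in\arg\min_\beta Q(\beta\mid\widehat\beta^{(1)}(\lambda),\lambda)$, with any choice of minimizers. Let $M_\lambda=\{j:\widehat\beta_j(\lambda)\ne0\}$ and, for numbers $C_n$ and $K_n>q$, $$\mathrm{HBIC}(\lambda)=\log\bigl(n^{-1}\|\mathbf y-\mathbf X\widehat\beta(\lambda)\|^2\bigr)+|M_\lambda|\,\frac{C_n\log p}{n},\qquad \widehat\lambda\in\arg\min\{\mathrm{HBIC}(\lambda):\lambda>0,\ |M_\lambda|\le K_n\}$$ ($\widehat\lambda$ is arbitrary where no minimizer exists). **Assumptions** (for all sufficiently large $n$,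 with constants not depending on $n$). * (A1) $\lambda_{\min}(G_{A_0})\ge C_1>0$. * (A2) The errors $\varepsilon_1,\dots,\varepsilon_n$ are i.i.d., centered, with $E e^{t\varepsilon_i}\le e^{\sigma^2t^2/2}$ for all $t$, $0<\sigma<\infty$. * (A3) For every $\lambda>0$: $p_\lambda$ is increasing (not necessarily strictly) and concave on $[0,\infty)$ with continuous derivative on $(0,\infty)$; $t\mapsto J_\lambda(|t|)$ is differentiable and concave; $\nabla J_\lambda(|t|)=-\lambda\,\mathrm{sign}(t)$ for $|t|>a\lambda$; and $|\nabla J_\lambda(|t|)|\le|t|$ for $|t|\le b\lambda$. Here $a>1$ and $0<b\le a$. * (A4′) There are constants $\alpha\ge1$ and $\kappa_{\min}>0$ with $\xi_{\min}((\alpha+1)q)\ge\kappa_{\min}$ and $$\frac{\xi_{\max}(\alpha q)}{\alpha}\le\frac{\kappa_{\min}}{576}\Bigl(1-3\sqrt{\tfrac{\xi_{\max}(\alpha q)}{\alpha\kappa_{\min}}}\Bigr)^2 .$$ * (A5) $\lambda=o(d_*)$ and $\tau=o(1)$. * (A6) $\zeta_{\max}((\alpha+1)q)$ and $\zeta_{\min}((\alpha+1)q)$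 are bounded by constants $\eta_{\max},\eta_{\min}<\infty$. **Theorem.** Under these assumptions: 1. For all sufficiently large $n$, $P(\widehat\beta(\lambda)=\widehat\beta^{(o)})\ge1-8p\exp[-n\tau^2\lambda^2/(8\sigma^2)]$. 2. If $n\tau^2\lambda^2\to\infty$ (automatic from the next condition when $p\ge2$) and $\log p=o(n\tau^2\lambda^2)$, then $P(\widehat\beta(\lambda)=\widehat\beta^{(o)})\to1$. 3. Suppose $\log p=o(n\tau^2\lambda^2)$, $p\to\infty$, $\mathrm{Var}(\varepsilon_i)\ge v$ for some constant $v>0$ (automatic for a fixed nondegenerate error law), and, for some constant $\kappa>0$ and all large $n$, $$\min_{A\not\supseteq A_0,\ |A|\le K_n} n^{-1}\|(I_n-P_A)\mathbf X_{A_0}\beta^*_{A_0}\|^2\ge\kappa,$$ where $P_A$ is the orthogonal projection onto the span of the columns of $\mathbf X_A$. If moreover $K_n>q$, $C_n\to\infty$, $qC_n\log p=o(n)$ and $K_n^2\log(p)\log(n)=o(n)$, then $P(M_{\widehat\lambda}=A_0)\to1$. In particular, a minimal signal $d_*\gg\tau^{-1}\sqrt{\log p/n}$ suffices: if $p\ge2$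 for all large $n$ and $\tau^{-1}\sqrt{\log p/n}=o(d_*)$, then there is a sequence $\lambda'>0$ with $\lambda'=o(d_*)$, $\tau^{-1}\sqrt{\log p/n}=o(\lambda')$ and $P(\widehat\beta(\lambda')=\widehat\beta^{(o)})\to1$. -/

import Mathlib

open MeasureTheory ProbabilityTheory Filter Topology Asymptotics
open scoped Matrix NNReal

noncomputable section

namespace CalibratedCCCP

/-! ### Vectors, submatrices, eigenvalues -/

/-- Squared Euclidean norm of a coordinate vector. -/
def sqNorm {ι : Type*} [Fintype ι] (v : ι → ℝ) : ℝ := ∑ i, v i ^ 2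

/-- The index set of the nonzero coordinates of `v`. For the true parameter this is `A₀`,
for an estimator it is the model it identifies. -/
def supp {p : ℕ} (v : Fin p → ℝ) : Finset (Fin p) := Finset.univ.filter fun j => v j ≠ 0

/-- `d_* = min { |v j| : v j ≠ 0 }` (meant for `v ≠ 0`). -/
def minSignal {p : ℕ} (v : Fin p → ℝ) : ℝ := sInf ((fun j => |v j|) '' {j | v j ≠ 0})

/-- `X_B`: the columns of `X` with index in `B`. -/
def cols {n p : ℕ} (X : Matrix (Fin n) (Fin p) ℝ) (B : Finset (Fin p)) : Matrix (Fin n) B ℝ :=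
  X.submatrix id Subtype.val

/-- `n⁻¹ X_Bᵀ X_B`. -/
def gram {n p : ℕ} (X : Matrix (Fin n) (Fin p) ℝ) (B : Finset (Fin p)) : Matrix B B ℝ :=
  (n : ℝ)⁻¹ • ((cols X B)ᵀ * cols X B)

/-- Smallest eigenvalue (of a symmetric matrix of positive size). -/
def lamMin {ι : Type*} [Fintype ι] [DecidableEq ι] (M : Matrix ι ι ℝ) : ℝ := sInf (spectrum ℝ M)

/-- Largest eigenvalue (of a symmetric matrix of positive size). -/
def lamMax {ι : Type*} [Fintype ι] [DecidableEq ι] (M : Matrix ι ι ℝ) : ℝ := sSup (spectrum ℝ M)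

/-- The norm `‖M‖₁ = max_i ∑_j |M i j|`. -/
def opNormOne {ι : Type*} [Fintype ι] (M : Matrix ι ι ℝ) : ℝ := ⨆ i, ∑ j, |M i j|

/-- The index sets `B` with `|B| ≤ m` and `A₀ ⊆ B`; nonempty exactly when `|A₀| ≤ m`. -/
def superModels {p : ℕ} (A₀ : Finset (Fin p)) (m : ℝ) : Set (Finset (Fin p)) :=
  {B | (B.card : ℝ) ≤ m ∧ A₀ ⊆ B}

def xiMin {n p : ℕ} (X : Matrix (Fin n) (Fin p) ℝ) (A₀ : Finset (Fin p)) (m : ℝ) : ℝ :=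
  sInf ((fun B => lamMin (gram X B)) '' superModels A₀ m)

def xiMax {n p : ℕ} (X : Matrix (Fin n) (Fin p) ℝ) (A₀ : Finset (Fin p)) (m : ℝ) : ℝ :=
  sSup ((fun B => lamMax (gram X B)) '' superModels A₀ m)

def zetaMax {n p : ℕ} (X : Matrix (Fin n) (Fin p) ℝ) (A₀ : Finset (Fin p)) (m : ℝ) : ℝ :=
  sSup ((fun B => opNormOne (gram X B)) '' superModels A₀ m)

def zetaMin {n p : ℕ} (X : Matrix (Fin n) (Fin p) ℝ) (A₀ : Finset (Fin p)) (m : ℝ) : ℝ :=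
  sSup ((fun B => opNormOne (gram X B)⁻¹) '' superModels A₀ m)

/-- The span of the columns of `X` with index in `A`, in Euclidean `n`-space. -/
def colSpan {n p : ℕ} (X : Matrix (Fin n) (Fin p) ℝ) (A : Finset (Fin p)) :
    Submodule ℝ (EuclideanSpace ℝ (Fin n)) :=
  Submodule.span ℝ ((fun j => WithLp.toLp 2 fun i => X i j) '' (A : Set (Fin p)))

/-- `‖(I - P_A) v‖²`, with `P_A` the orthogonal projection onto the span of the columns
with index in `A`. -/
def residualSq {n p : ℕ} (X : Matrix (Fin n) (Fin p) ℝ) (A : Finset (Fin p))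
    (v : Fin n → ℝ) : ℝ :=
  ‖WithLp.toLp 2 v - (colSpan X A).starProjection (WithLp.toLp 2 v)‖ ^ 2

/-! ### Penalty -/

/-- `t ↦ J_l(|t|)`, from the decomposition `p_l(|t|) = J_l(|t|) + l |t|`. -/
def penJ (pen : ℝ → ℝ → ℝ) (l t : ℝ) : ℝ := pen l |t| - l * |t|

/-- `∇ J_l(|t|)`: the derivative of `t ↦ J_l(|t|)`. -/
def gradJ (pen : ℝ → ℝ → ℝ) (l t : ℝ) : ℝ := deriv (penJ pen l) t

/-- The class of nonconvex penalties `p_l(t) = pen l t`, `t ≥ 0`, `l > 0`, with constants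
`a` and `b` common to all `l`. -/
structure IsNonconvexPenalty (pen : ℝ → ℝ → ℝ) (a b : ℝ) : Prop where
  one_lt_a : 1 < a
  b_pos : 0 < b
  b_le_a : b ≤ a
  monotone : ∀ l > 0, MonotoneOn (pen l) (Set.Ici 0)
  concave : ∀ l > 0, ConcaveOn ℝ (Set.Ici 0) (pen l)
  differentiable : ∀ l > 0, DifferentiableOn ℝ (pen l) (Set.Ioi 0)
  continuous_deriv : ∀ l > 0, ContinuousOn (deriv (pen l)) (Set.Ioi 0)
  differentiable_J : ∀ l > 0, Differentiable ℝ (penJ pen l)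
  concave_J : ∀ l > 0, ConcaveOn ℝ Set.univ (penJ pen l)
  grad_large : ∀ l > 0, ∀ t : ℝ, a * l < |t| → gradJ pen l t = -l * Real.sign t
  grad_small : ∀ l > 0, ∀ t : ℝ, |t| ≤ b * l → |gradJ pen l t| ≤ |t|

/-! ### Estimators -/

/-- The tight convex upper bound `Q(β | β₀, l)`. -/
def Qfun {n p : ℕ} (pen : ℝ → ℝ → ℝ) (X : Matrix (Fin n) (Fin p) ℝ) (y : Fin n → ℝ)
    (β₀ : Fin p → ℝ) (l : ℝ) (β : Fin p → ℝ) : ℝ :=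
  1 / (2 * (n : ℝ)) * sqNorm (y - X *ᵥ β) + ∑ j, gradJ pen l (β₀ j) * β j + l * ∑ j, |β j|

/-- `b` is a global minimizer of `f`. -/
def IsArgmin {E : Type*} (f : E → ℝ) (b : E) : Prop := ∀ b', f b ≤ f b'

/-- `β` is an outcome of the two-step calibrated CCCP algorithm started at `0`:
step one uses the tuning parameter `τ * l`, step two uses `l`. -/
def IsCalibratedCCCP {n p : ℕ} (pen : ℝ → ℝ → ℝ) (X : Matrix (Fin n) (Fin p) ℝ)
    (y : Fin n → ℝ) (τ l : ℝ) (β : Fin p → ℝ) : Prop :=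
  ∃ β₁ : Fin p → ℝ, IsArgmin (Qfun pen X y 0 (τ * l)) β₁ ∧ IsArgmin (Qfun pen X y β₁ l) β

/-- The oracle estimator: the least squares estimator `(X_Aᵀ X_A)⁻¹ X_Aᵀ y` on the
coordinates in `A`, zero elsewhere. -/
def oracle {n p : ℕ} (X : Matrix (Fin n) (Fin p) ℝ) (A : Finset (Fin p)) (y : Fin n → ℝ) :
    Fin p → ℝ := fun j =>
  if h : j ∈ A then (((cols X A)ᵀ * cols X A)⁻¹ *ᵥ ((cols X A)ᵀ *ᵥ y)) ⟨j, h⟩ else 0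

/-- The high-dimensional BIC of an estimate `β`. -/
def hbic {n p : ℕ} (X : Matrix (Fin n) (Fin p) ℝ) (y : Fin n → ℝ) (C : ℝ) (β : Fin p → ℝ) : ℝ :=
  Real.log (sqNorm (y - X *ᵥ β) / n) + (supp β).card * (C * Real.log p / n)

/-- `l` minimizes the HBIC along the path `path` over
`Λ = { l > 0 : the model at l has at most K elements }`. -/
def IsHBICMin {n p : ℕ} (X : Matrix (Fin n) (Fin p) ℝ) (y : Fin n → ℝ) (C K : ℝ)
    (path : ℝ → Fin p → ℝ) (l : ℝ) : Prop :=
  (0 < l ∧ ((supp (path l)).card : ℝ) ≤ K) ∧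
    ∀ l' : ℝ, 0 < l' → ((supp (path l')).card : ℝ) ≤ K →
      hbic X y C (path l) ≤ hbic X y C (path l')

/-! ### Probability -/

/-- Inner probability of an event. It is the probability if the event is measurable, and never
larger than the outer measure `μ.real E`; it lets us speak of arbitrary selections of
minimizers without a measurability assumption on them. -/
def prob {Ω : Type*} [MeasurableSpace Ω] (μ : Measure Ω) (E : Set Ω) : ℝ := 1 - μ.real Eᶜ

theorem prob_eq {Ω : Type*} [MeasurableSpace Ω] (μ : Measure Ω) [IsProbabilityMeasure μ]
    {E : Set Ω} (hE : MeasurableSet E) : prob μ E = μ.real E := by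
  have h := measureReal_add_measureReal_compl (μ := μ) hE
  rw [probReal_univ] at h
  unfold prob
  linarith

/-- The errors are i.i.d., centered and sub-Gaussian with scale factor `σ`:
`E exp(t ε_i) ≤ exp(σ² t² / 2)` for all `t`. -/
structure IsSubgaussianNoise {n : ℕ} {Ω : Type*} [MeasurableSpace Ω] (μ : Measure Ω)
    (ε : Fin n → Ω → ℝ) (σ : ℝ≥0) : Prop where
  indep : iIndepFun ε μ
  identDistrib : ∀ i j, IdentDistrib (ε i) (ε j) μ μ
  mean_zero : ∀ i, ∫ ω, ε i ω ∂μ = 0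
  subgaussian : ∀ i, HasSubgaussianMGF (ε i) (σ ^ 2) μ

/-- The response `y = X β* + ε`. -/
def response {n p : ℕ} {Ω : Type*} (X : Matrix (Fin n) (Fin p) ℝ) (βs : Fin p → ℝ)
    (ε : Fin n → Ω → ℝ) (ω : Ω) : Fin n → ℝ := X *ᵥ βs + fun i => ε i ω

end CalibratedCCCP

end

namespace CalibratedCCCP

/-! ### Sparse vectors and block decompositions -/

lemma exists_subset_card_eq_of_largest {ι : Type*} [DecidableEq ι] (f : ι → ℝ) (T : Finset ι) :
    ∀ m ≤ T.card, ∃ S ⊆ T, S.card = m ∧ ∀ i ∈ S, ∀ j ∈ T \ S, f j ≤ f i := by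
  intro m
  induction m with
  | zero => exact fun _ => ⟨∅, by simp, by simp, by simp⟩
  | succ m ih =>
    intro hm
    obtain ⟨S, hST, hcard, hS⟩ := ih (by omega)
    have hne : (T \ S).Nonempty := by
      rw [← Finset.card_pos, Finset.card_sdiff_of_subset hST]; omega
    obtain ⟨i₀, hi₀, hmax⟩ := Finset.exists_max_image (T \ S) f hne
    rw [Finset.mem_sdiff] at hi₀
    refine ⟨insert i₀ S, Finset.insert_subset hi₀.1 hST, ?_, ?_⟩
    · rw [Finset.card_insert_of_notMem hi₀.2, hcard]
    · intro i hi j hj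
      have hj' : j ∈ T \ S := by
        simp only [Finset.mem_sdiff, Finset.mem_insert, not_or] at hj ⊢
        exact ⟨hj.1, hj.2.2⟩
      rcases Finset.mem_insert.1 hi with rfl | hi
      · exact hmax j hj'
      · exact hS i hi j hj'

/-- The vector `w` with the coordinates outside `S` set to zero. -/
def restrictTo {ι : Type*} [DecidableEq ι] (S : Finset ι) (w : ι → ℝ) : ι → ℝ :=
  fun j => if j ∈ S then w j else 0

lemma restrictTo_add_of_disjoint {ι : Type*} [DecidableEq ι] {S T : Finset ι} (h : Disjoint S T)
    (w : ι → ℝ) : restrictTo (S ∪ T) w = restrictTo S w + restrictTo T w := by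
  ext j
  simp only [restrictTo, Finset.mem_union, Pi.add_apply]
  by_cases h1 : j ∈ S
  · simp [h1, Finset.disjoint_left.1 h h1]
  · simp [h1]

lemma sqNorm_restrictTo {ι : Type*} [Fintype ι] [DecidableEq ι] (S : Finset ι) (w : ι → ℝ) :
    sqNorm (restrictTo S w) = ∑ i ∈ S, w i ^ 2 := by
  simp [sqNorm, restrictTo, ite_pow, Finset.sum_ite_mem]

lemma supp_restrictTo_subset {p : ℕ} (S : Finset (Fin p)) (w : Fin p → ℝ) :
    supp (restrictTo S w) ⊆ S := by
  intro j hj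
  by_contra h
  simp [supp, restrictTo, h] at hj

lemma eq_zero_of_notMem_supp {p : ℕ} {w : Fin p → ℝ} {j : Fin p} (h : j ∉ supp w) : w j = 0 := by
  simpa [supp] using h

lemma mem_supp {p : ℕ} {w : Fin p → ℝ} {j : Fin p} : j ∈ supp w ↔ w j ≠ 0 := by
  simp [supp]

lemma sqNorm_nonneg {ι : Type*} [Fintype ι] (v : ι → ℝ) : 0 ≤ sqNorm v :=
  Finset.sum_nonneg fun _ _ => sq_nonneg _

lemma sqNorm_eq_norm_sq {ι : Type*} [Fintype ι] (v : ι → ℝ) :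
    sqNorm v = ‖WithLp.toLp 2 v‖ ^ 2 := by
  rw [EuclideanSpace.real_norm_sq_eq]; rfl

lemma sqNorm_eq_dotProduct {ι : Type*} [Fintype ι] (v : ι → ℝ) : sqNorm v = v ⬝ᵥ v := by
  simp [sqNorm, dotProduct, sq]

lemma sqNorm_sub {ι : Type*} [Fintype ι] (u v : ι → ℝ) :
    sqNorm (u - v) = sqNorm u - 2 * (u ⬝ᵥ v) + sqNorm v := by
  simp only [sqNorm_eq_dotProduct, sub_dotProduct, dotProduct_sub, dotProduct_comm v u]
  ring

lemma dotProduct_sq_le {ι : Type*} [Fintype ι] (u v : ι → ℝ) :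
    (u ⬝ᵥ v) ^ 2 ≤ sqNorm u * sqNorm v := by
  simpa [dotProduct, sqNorm] using Finset.sum_mul_sq_le_sq_mul_sq Finset.univ u v

/-- If a linear map is bounded by `C` on `m`-sparse vectors, then on arbitrary vectors it is
controlled by the sup norm and the `ℓ₁` norm. -/
lemma norm_map_restrictTo_le {ι E : Type*} [DecidableEq ι] [SeminormedAddCommGroup E] [Module ℝ E]
    (L : (ι → ℝ) →ₗ[ℝ] E) (w : ι → ℝ) {C : ℝ} (hC : 0 ≤ C) {m : ℕ} (hm : 0 < m) (U : Finset ι)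
    (hL : ∀ S ⊆ U, S.card ≤ m → ‖L (restrictTo S w)‖ ≤ C * √(∑ i ∈ S, w i ^ 2)) (N : ℕ) :
    ∀ T ⊆ U, T.card ≤ N → ∀ M, 0 ≤ M → (∀ i ∈ T, |w i| ≤ M) →
      ‖L (restrictTo T w)‖ ≤ C * (√m * M + (∑ i ∈ T, |w i|) / √m) := by
  have hm0 : (0 : ℝ) < m := by exact_mod_cast hm
  have hsm : 0 < √(m : ℝ) := Real.sqrt_pos.2 hm0
  have hsq : √(m : ℝ) * √(m : ℝ) = m := Real.mul_self_sqrt hm0.le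
  have hsmall : ∀ S ⊆ U, S.card ≤ m → ∀ M, 0 ≤ M → (∀ i ∈ S, |w i| ≤ M) →
      ‖L (restrictTo S w)‖ ≤ C * (√m * M) := by
    intro S hS hc M hM hw
    refine (hL S hS hc).trans (mul_le_mul_of_nonneg_left ?_ hC)
    rw [Real.sqrt_le_left (by positivity), mul_pow, Real.sq_sqrt hm0.le]
    calc ∑ i ∈ S, w i ^ 2 ≤ ∑ _i ∈ S, M ^ 2 :=
          Finset.sum_le_sum fun i hi => by rw [← sq_abs]; gcongr; exact hw i hi
      _ = S.card * M ^ 2 := by simp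
      _ ≤ m * M ^ 2 := by gcongr
  induction N with
  | zero =>
    intro T hT hc M hM hw
    refine (hsmall T hT (by omega) M hM hw).trans (mul_le_mul_of_nonneg_left ?_ hC)
    have : 0 ≤ (∑ i ∈ T, |w i|) / √m := by positivity
    linarith
  | succ N ih =>
    intro T hT hc M hM hw
    by_cases hTm : T.card ≤ m
    · refine (hsmall T hT hTm M hM hw).trans (mul_le_mul_of_nonneg_left ?_ hC)
      have : 0 ≤ (∑ i ∈ T, |w i|) / √m := by positivity
      linarith
    · obtain ⟨S, hST, hcard, htop⟩ :=
        exists_subset_card_eq_of_largest (fun i => |w i|) T m (by omega)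
      have hrest : ‖L (restrictTo (T \ S) w)‖ ≤
          C * (√m * ((∑ i ∈ S, |w i|) / m) + (∑ i ∈ T \ S, |w i|) / √m) := by
        refine ih (T \ S) (Finset.sdiff_subset.trans hT) ?_ _ (by positivity) ?_
        · rw [Finset.card_sdiff_of_subset hST]; omega
        · intro j hj
          rw [le_div_iff₀ hm0]
          calc |w j| * m = ∑ _i ∈ S, |w j| := by simp [hcard, mul_comm]
            _ ≤ _ := Finset.sum_le_sum fun i hi => htop i hi j hj
      have hsplit : restrictTo T w = restrictTo S w + restrictTo (T \ S) w := by
        rw [← restrictTo_add_of_disjoint Finset.disjoint_sdiff, Finset.union_sdiff_of_subset hST]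
      have hsum : ∑ i ∈ T, |w i| = ∑ i ∈ T \ S, |w i| + ∑ i ∈ S, |w i| :=
        (Finset.sum_sdiff hST).symm
      rw [hsplit, map_add]
      refine (norm_add_le _ _).trans ((add_le_add (hsmall S (hST.trans hT) hcard.le M hM
        fun i hi => hw i (hST hi)) hrest).trans (le_of_eq ?_))
      rw [hsum]
      have : √(m : ℝ) * ((∑ i ∈ S, |w i|) / m) = (∑ i ∈ S, |w i|) / √m := by
        nth_rewrite 2 [← hsq]; field_simp
      rw [this]; ring

/-- `w ↦ X w` as a linear map into Euclidean space. -/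
noncomputable def designMap {n p : ℕ} (X : Matrix (Fin n) (Fin p) ℝ) :
    (Fin p → ℝ) →ₗ[ℝ] EuclideanSpace ℝ (Fin n) :=
  (WithLp.linearEquiv 2 ℝ (Fin n → ℝ)).symm.toLinearMap ∘ₗ X.mulVecLin

lemma norm_designMap_sq {n p : ℕ} (X : Matrix (Fin n) (Fin p) ℝ) (w : Fin p → ℝ) :
    ‖designMap X w‖ ^ 2 = sqNorm (X *ᵥ w) := by
  rw [sqNorm_eq_norm_sq]; rfl

lemma sqNorm_mulVec_le_iff {n p : ℕ} (X : Matrix (Fin n) (Fin p) ℝ) (w : Fin p → ℝ) {c : ℝ}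
    (hc : 0 ≤ c) :
    sqNorm (X *ᵥ w) ≤ c ↔ ‖designMap X w‖ ≤ √c := by
  rw [← norm_designMap_sq, Real.le_sqrt (norm_nonneg _) hc]

/-- Sparse eigenvalue and sup-norm bounds of a standardized design, for index sets that contain
the model `A` and have at most `|A| (k + 1)` elements. -/
structure SparseDesign {n p : ℕ} (X : Matrix (Fin n) (Fin p) ℝ) (A : Finset (Fin p)) (k : ℕ)
    (κ η H : ℝ) : Prop where
  n_pos : 0 < n
  nonempty : A.Nonempty
  k_pos : 0 < k
  kappa_pos : 0 < κ
  eta_nonneg : 0 ≤ η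
  std : ∀ j, ∑ i, X i j ^ 2 = n
  lower : ∀ w, (supp w ∪ A).card ≤ A.card * (k + 1) → n * κ * sqNorm w ≤ sqNorm (X *ᵥ w)
  upper : ∀ w, (supp w ∪ A).card ≤ A.card * (k + 1) →
    sqNorm (X *ᵥ w) ≤ n * κ * k / 364 * sqNorm w
  sup_le : ∀ w, (supp w ∪ A).card ≤ A.card * (k + 1) → ∀ c,
    (∀ j ∈ supp w ∪ A, |(Xᵀ *ᵥ (X *ᵥ w)) j| ≤ n * c) → ∀ j, |w j| ≤ η * c
  row_le : ∀ w, supp w ⊆ A → ∀ c, 0 ≤ c → (∀ j, |w j| ≤ c) →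
    ∀ j, |(Xᵀ *ᵥ (X *ᵥ w)) j| ≤ n * (H * c)

namespace SparseDesign

variable {n p : ℕ} {X : Matrix (Fin n) (Fin p) ℝ} {A : Finset (Fin p)} {k : ℕ} {κ η H : ℝ}

/-- The restricted eigenvalue condition. -/
lemma restricted_eigenvalue (h : SparseDesign X A k κ η H) (δ : Fin p → ℝ)
    (hcone : ∑ j ∈ Aᶜ, |δ j| ≤ 3 * ∑ j ∈ A, |δ j|) :
    7 / 10 * (n * κ) * ∑ j ∈ A, δ j ^ 2 ≤ sqNorm (X *ᵥ δ) := by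
  have hn : (0 : ℝ) < n := by exact_mod_cast h.n_pos
  have hκ := h.kappa_pos
  have hk : (0 : ℝ) < k := by exact_mod_cast h.k_pos
  have hq : (0 : ℝ) < A.card := by exact_mod_cast h.nonempty.card_pos
  set m := A.card * k with hmdef
  have hm : 0 < m := Nat.mul_pos h.nonempty.card_pos h.k_pos
  have hm0 : (0 : ℝ) < m := by exact_mod_cast hm
  obtain ⟨S, hSA, hScard, hStop⟩ := exists_subset_card_eq_of_largest (fun i => |δ i|) Aᶜ
    (min m Aᶜ.card) (min_le_right _ _)
  have hdisj : Disjoint A S := Finset.disjoint_left.2 fun j hj hj' => by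
    simpa [hj] using hSA hj'
  set R := Aᶜ \ S
  have hM : ∀ j ∈ R, |δ j| ≤ (∑ i ∈ S, |δ i|) / m := by
    intro j hj
    have hlt : S.card < Aᶜ.card := by
      have : (Aᶜ \ S).card = Aᶜ.card - S.card := Finset.card_sdiff_of_subset hSA
      have h2 : 0 < (Aᶜ \ S).card := Finset.card_pos.2 ⟨j, hj⟩
      omega
    have hSm : S.card = m := by omega
    rw [le_div_iff₀ hm0]
    calc |δ j| * m = ∑ _i ∈ S, |δ j| := by simp [hSm, mul_comm]
      _ ≤ _ := Finset.sum_le_sum fun i hi => hStop i hi j hj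
  set C := √(n * κ * k / 364) with hC
  have hrest : ‖designMap X (restrictTo R δ)‖ ≤
      C * (√m * ((∑ i ∈ S, |δ i|) / m) + (∑ i ∈ R, |δ i|) / √m) := by
    refine norm_map_restrictTo_le (designMap X) δ (Real.sqrt_nonneg _) hm Aᶜ ?_ R.card R
      Finset.sdiff_subset le_rfl _ (by positivity) hM
    intro T hT hTm
    have hcard : (supp (restrictTo T δ) ∪ A).card ≤ A.card * (k + 1) := by
      refine (Finset.card_union_le _ _).trans ?_
      have := (Finset.card_le_card (supp_restrictTo_subset T δ)).trans hTm
      rw [mul_add, mul_one]; omega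
    have := h.upper _ hcard
    rw [sqNorm_mulVec_le_iff _ _ (mul_nonneg (by positivity) (sqNorm_nonneg _)),
      Real.sqrt_mul (by positivity), sqNorm_restrictTo] at this
    exact this
  have hsm : 0 < √(m : ℝ) := Real.sqrt_pos.2 hm0
  have hsq : √(m : ℝ) * √(m : ℝ) = m := Real.mul_self_sqrt hm0.le
  set D := √(∑ j ∈ A, δ j ^ 2) with hD
  have hD0 : 0 ≤ D := Real.sqrt_nonneg _
  have hD2 : D ^ 2 = ∑ j ∈ A, δ j ^ 2 := Real.sq_sqrt (Finset.sum_nonneg fun _ _ => sq_nonneg _)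
  have hl1 : ∑ j ∈ A, |δ j| ≤ √A.card * D := by
    rw [hD, ← Real.sqrt_mul hq.le]
    apply Real.le_sqrt_of_sq_le
    have := sq_sum_le_card_mul_sum_sq (s := A) (f := fun j => |δ j|)
    simpa using this
  have hrest' : ‖designMap X (restrictTo R δ)‖ ≤ 3 / 19 * √(n * κ) * D := by
    have hsum : ∑ i ∈ R, |δ i| + ∑ i ∈ S, |δ i| = ∑ i ∈ Aᶜ, |δ i| := Finset.sum_sdiff hSA
    have e1 : √(m : ℝ) * ((∑ i ∈ S, |δ i|) / m) + (∑ i ∈ R, |δ i|) / √m =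
        (∑ i ∈ Aᶜ, |δ i|) / √m := by
      rw [← hsum]; nth_rewrite 2 [← hsq]; field_simp; ring
    rw [e1] at hrest
    refine hrest.trans ?_
    have e2 : (∑ i ∈ Aᶜ, |δ i|) / √m ≤ 3 * D / √k := by
      have : √(m : ℝ) = √A.card * √k := by
        rw [hmdef]; push_cast; exact Real.sqrt_mul hq.le _
      rw [this, div_le_div_iff₀ (by positivity) (by positivity)]
      have : (∑ i ∈ Aᶜ, |δ i|) ≤ 3 * (√A.card * D) := by linarith
      calc (∑ i ∈ Aᶜ, |δ i|) * √k ≤ 3 * (√A.card * D) * √k := by gcongr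
        _ = _ := by ring
    have e3 : C ≤ √(n * κ) * √k / 19 := by
      rw [hC, ← Real.sqrt_mul (by positivity)]
      rw [Real.sqrt_le_left (by positivity), div_pow, Real.sq_sqrt (by positivity)]
      apply div_le_div_of_nonneg_left (by positivity) (by norm_num) (by norm_num)
    calc C * ((∑ i ∈ Aᶜ, |δ i|) / √m) ≤ √(n * κ) * √k / 19 * (3 * D / √k) := by
          gcongr
      _ = _ := by
          have : √(k : ℝ) ≠ 0 := (Real.sqrt_pos.2 hk).ne'
          field_simp
  have hmain : √(n * κ) * D ≤ ‖designMap X (restrictTo (A ∪ S) δ)‖ := by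
    have hcard : (supp (restrictTo (A ∪ S) δ) ∪ A).card ≤ A.card * (k + 1) := by
      have h1 : supp (restrictTo (A ∪ S) δ) ∪ A ⊆ A ∪ S :=
        Finset.union_subset (supp_restrictTo_subset _ _) Finset.subset_union_left
      refine (Finset.card_le_card h1).trans ((Finset.card_union_le _ _).trans ?_)
      rw [mul_add, mul_one]; omega
    have h2 := h.lower _ hcard
    rw [← norm_designMap_sq, sqNorm_restrictTo] at h2
    rw [hD, ← Real.sqrt_mul (by positivity)]
    rw [Real.sqrt_le_left (norm_nonneg _)]
    refine le_trans ?_ h2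
    gcongr
    exact Finset.subset_union_left
  have hsplit : δ = restrictTo (A ∪ S) δ + restrictTo R δ := by
    have hd : Disjoint (A ∪ S) R := by
      rw [Finset.disjoint_union_left]
      exact ⟨Finset.disjoint_left.2 fun j hj hj' => by simp [R, hj] at hj',
        Finset.disjoint_sdiff⟩
    rw [← restrictTo_add_of_disjoint hd]
    ext j
    have : j ∈ A ∪ S ∪ R := by
      simp only [R, Finset.mem_union, Finset.mem_sdiff, Finset.mem_compl]
      tauto
    exact (if_pos this).symm
  have hfin : 16 / 19 * √(n * κ) * D ≤ ‖designMap X δ‖ := by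
    have h1 : ‖designMap X (restrictTo (A ∪ S) δ)‖ ≤
        ‖designMap X δ‖ + ‖designMap X (restrictTo R δ)‖ := by
      have : designMap X (restrictTo (A ∪ S) δ) = designMap X δ - designMap X (restrictTo R δ) := by
        rw [← map_sub]; congr 1; nth_rewrite 2 [hsplit]; simp
      rw [this]; exact norm_sub_le _ _
    linarith
  rw [← norm_designMap_sq, ← hD2]
  have h0 : 0 ≤ 16 / 19 * √(n * κ) * D := by positivity
  have h1 := pow_le_pow_left₀ h0 hfin 2
  have h2 : (16 / 19 * √(n * κ) * D) ^ 2 = 256 / 361 * (n * κ) * D ^ 2 := by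
    rw [mul_pow, mul_pow, Real.sq_sqrt (by positivity)]; norm_num
  rw [h2] at h1
  have h3 : 0 ≤ n * κ * D ^ 2 := by positivity
  linarith

end SparseDesign
/-! ### The lasso and the weighted second step -/

lemma dotProduct_transpose_mulVec {m n : Type*} [Fintype m] [Fintype n] (X : Matrix m n ℝ)
    (d : n → ℝ) (v : m → ℝ) : d ⬝ᵥ (Xᵀ *ᵥ v) = v ⬝ᵥ (X *ᵥ d) := by
  rw [Matrix.mulVec_transpose, Matrix.dotProduct_mulVec, dotProduct_comm]

lemma sqNorm_response_sub {n p : ℕ} (X : Matrix (Fin n) (Fin p) ℝ) (y : Fin n → ℝ)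
    (b d : Fin p → ℝ) :
    sqNorm (y - X *ᵥ (b + d)) =
      sqNorm (y - X *ᵥ b) - 2 * (d ⬝ᵥ (Xᵀ *ᵥ (y - X *ᵥ b))) + sqNorm (X *ᵥ d) := by
  rw [Matrix.mulVec_add, ← sub_sub, sqNorm_sub, dotProduct_transpose_mulVec]

lemma abs_dotProduct_le {ι : Type*} [Fintype ι] (u v : ι → ℝ) {c : ℝ} (hv : ∀ j, |v j| ≤ c) :
    |u ⬝ᵥ v| ≤ c * ∑ j, |u j| := by
  rw [Finset.mul_sum]
  refine (Finset.abs_sum_le_sum_abs _ _).trans (Finset.sum_le_sum fun j _ => ?_)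
  rw [abs_mul, mul_comm]
  exact mul_le_mul_of_nonneg_right (hv j) (abs_nonneg _)

/-- The lasso criterion. -/
noncomputable def lassoObj {n p : ℕ} (X : Matrix (Fin n) (Fin p) ℝ) (y : Fin n → ℝ) (l : ℝ)
    (b : Fin p → ℝ) : ℝ :=
  1 / (2 * (n : ℝ)) * sqNorm (y - X *ᵥ b) + l * ∑ j, |b j|

lemma abs_le_of_quadratic_min {b c l : ℝ}
    (h : ∀ t : ℝ, 0 ≤ -t * c + t ^ 2 / 2 + l * (|b + t| - |b|)) (hl : 0 < l) : |c| ≤ l := by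
  have h' : ∀ t : ℝ, 0 ≤ -t * c + t ^ 2 / 2 + l * |t| := fun t => by
    have h1 : |b + t| - |b| ≤ |t| := by linarith [abs_add_le b t]
    nlinarith [h t, mul_le_mul_of_nonneg_left h1 hl.le]
  rw [abs_le]
  constructor
  · by_contra! hc
    have := h' (c + l)
    rw [abs_of_neg (by linarith)] at this
    nlinarith [mul_pos_of_neg_of_neg (show c + l < 0 by linarith) (show c + l < 0 by linarith)]
  · by_contra! hc
    have := h' (c - l)
    rw [abs_of_pos (by linarith)] at this
    nlinarith [mul_pos (show 0 < c - l by linarith) (show 0 < c - l by linarith)]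

lemma le_abs_of_quadratic_min {b c l : ℝ}
    (h : ∀ t : ℝ, 0 ≤ -t * c + t ^ 2 / 2 + l * (|b + t| - |b|)) (hb : b ≠ 0) : l ≤ |c| := by
  have key : ∀ b c : ℝ, 0 < b → (∀ t : ℝ, 0 ≤ -t * c + t ^ 2 / 2 + l * (|b + t| - |b|)) →
      l ≤ c := by
    intro b c hb h
    by_contra! hc
    have hs : 0 < min b (l - c) := lt_min hb (by linarith)
    have h1 := h (-(min b (l - c)))
    rw [abs_of_nonneg (by linarith [min_le_left b (l - c)]), abs_of_pos hb] at h1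
    nlinarith [min_le_right b (l - c)]
  rcases lt_or_gt_of_ne hb with hb | hb
  · refine (key (-b) (-c) (by linarith) fun t => ?_).trans (neg_le_abs c)
    have := h (-t)
    rw [show |-b + t| = |b + -t| by rw [← abs_neg]; ring_nf, abs_neg b]
    linarith
  · exact (key b c hb h).trans (le_abs_self c)

lemma lasso_coordinate {n p : ℕ} {X : Matrix (Fin n) (Fin p) ℝ} {y : Fin n → ℝ} {l : ℝ}
    {b : Fin p → ℝ} (hn : 0 < n) (hmin : IsArgmin (lassoObj X y l) b) (j : Fin p)
    (hstd : ∑ i, X i j ^ 2 = n) (t : ℝ) :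
    0 ≤ -t * ((Xᵀ *ᵥ (y - X *ᵥ b)) j / n) + t ^ 2 / 2 + l * (|b j + t| - |b j|) := by
  have hn' : (0 : ℝ) < n := by exact_mod_cast hn
  have h := hmin (b + Pi.single j t)
  unfold lassoObj at h
  have h1 : ∑ k, |(b + Pi.single j t : Fin p → ℝ) k| = ∑ k, |b k| + (|b j + t| - |b j|) := by
    rw [← sub_eq_iff_eq_add', ← Finset.sum_sub_distrib, Finset.sum_eq_single j]
    · simp
    · intro k _ hk; simp [hk]
    · simp
  have h2 : sqNorm (X *ᵥ Pi.single j t) = t ^ 2 * n := by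
    rw [← hstd, Finset.mul_sum]
    simp [sqNorm, Matrix.mulVec_single, mul_pow, mul_comm]
  rw [sqNorm_response_sub, h1, h2, single_dotProduct] at h
  have h3 : 1 / (2 * (n : ℝ)) * (sqNorm (y - X *ᵥ b) -
      2 * (t * (Xᵀ *ᵥ (y - X *ᵥ b)) j) + t ^ 2 * n) =
      1 / (2 * (n : ℝ)) * sqNorm (y - X *ᵥ b) +
        (-t * ((Xᵀ *ᵥ (y - X *ᵥ b)) j / n) + t ^ 2 / 2) := by
    field_simp; ring
  rw [h3] at h
  linarith

lemma lasso_abs_gradient_le {n p : ℕ} {X : Matrix (Fin n) (Fin p) ℝ} {y : Fin n → ℝ} {l : ℝ}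
    {b : Fin p → ℝ} (hn : 0 < n) (hl : 0 < l) (hmin : IsArgmin (lassoObj X y l) b) (j : Fin p)
    (hstd : ∑ i, X i j ^ 2 = n) : |(Xᵀ *ᵥ (y - X *ᵥ b)) j| ≤ n * l := by
  have hn' : (0 : ℝ) < n := by exact_mod_cast hn
  have := abs_le_of_quadratic_min (lasso_coordinate hn hmin j hstd) hl
  rwa [abs_div, abs_of_pos hn', div_le_iff₀ hn', mul_comm] at this

lemma lasso_le_abs_gradient {n p : ℕ} {X : Matrix (Fin n) (Fin p) ℝ} {y : Fin n → ℝ} {l : ℝ}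
    {b : Fin p → ℝ} (hn : 0 < n) (hmin : IsArgmin (lassoObj X y l) b) (j : Fin p)
    (hstd : ∑ i, X i j ^ 2 = n) (hj : b j ≠ 0) : n * l ≤ |(Xᵀ *ᵥ (y - X *ᵥ b)) j| := by
  have hn' : (0 : ℝ) < n := by exact_mod_cast hn
  have := le_abs_of_quadratic_min (lasso_coordinate hn hmin j hstd) hj
  rwa [abs_div, abs_of_pos hn', le_div_iff₀ hn', mul_comm] at this

namespace SparseDesign

variable {n p : ℕ} {X : Matrix (Fin n) (Fin p) ℝ} {A : Finset (Fin p)} {k : ℕ} {κ η H : ℝ}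

lemma lasso_basic_inequality (hn : 0 < n) {βs b : Fin p → ℝ} {ε : Fin n → ℝ} {l : ℝ}
    (hl : 0 < l) (hA : supp βs = A) (hε : ∀ j, |(Xᵀ *ᵥ ε) j| ≤ n * (l / 2))
    (hmin : IsArgmin (lassoObj X (X *ᵥ βs + ε) l) b) :
    sqNorm (X *ᵥ (b - βs)) ≤
      n * l * (3 * ∑ j ∈ A, |(b - βs) j| - ∑ j ∈ Aᶜ, |(b - βs) j|) := by
  have hn' : (0 : ℝ) < n := by exact_mod_cast hn
  have h := hmin βs
  unfold lassoObj at h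
  have hb : b = βs + (b - βs) := by abel
  have hr : X *ᵥ βs + ε - X *ᵥ βs = ε := by abel
  have h1 := sqNorm_response_sub X (X *ᵥ βs + ε) βs (b - βs)
  rw [← hb, hr] at h1
  rw [h1, hr] at h
  have h2 := (abs_le.1 (abs_dotProduct_le (b - βs) (Xᵀ *ᵥ ε) hε)).2
  have h3 : ∑ j, |βs j| - ∑ j, |b j| ≤ ∑ j ∈ A, |(b - βs) j| - ∑ j ∈ Aᶜ, |(b - βs) j| := by
    rw [← Finset.sum_sub_distrib, ← Finset.sum_add_sum_compl A, sub_eq_add_neg, ← Finset.sum_neg_distrib]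
    refine add_le_add (Finset.sum_le_sum fun j _ => ?_) (Finset.sum_le_sum fun j hj => ?_)
    · rw [Pi.sub_apply, abs_sub_comm]; exact abs_sub_abs_le_abs_sub _ _
    · have : βs j = 0 := eq_zero_of_notMem_supp (by rw [hA]; simpa using hj)
      simp [this]
  have h4 := Finset.sum_add_sum_compl A fun j => |(b - βs) j|
  rw [← h4] at h2
  have h5 : 1 / (2 * (n : ℝ)) *
      (sqNorm ε - 2 * (b - βs) ⬝ᵥ Xᵀ *ᵥ ε + sqNorm (X *ᵥ (b - βs))) =
      1 / (2 * (n : ℝ)) * sqNorm ε + 1 / (2 * (n : ℝ)) *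
        (sqNorm (X *ᵥ (b - βs)) - 2 * (b - βs) ⬝ᵥ Xᵀ *ᵥ ε) := by ring
  have h6 : 1 / (2 * (n : ℝ)) * (sqNorm (X *ᵥ (b - βs)) - 2 * (b - βs) ⬝ᵥ Xᵀ *ᵥ ε) ≤
      l * (∑ j ∈ A, |(b - βs) j| - ∑ j ∈ Aᶜ, |(b - βs) j|) := by
    have := mul_le_mul_of_nonneg_left h3 hl.le
    linarith
  rw [one_div, inv_mul_le_iff₀ (by positivity)] at h6
  nlinarith

lemma lasso_prediction (h : SparseDesign X A k κ η H) {βs b : Fin p → ℝ} {ε : Fin n → ℝ} {l : ℝ}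
    (hl : 0 < l) (hA : supp βs = A) (hε : ∀ j, |(Xᵀ *ᵥ ε) j| ≤ n * (l / 2))
    (hmin : IsArgmin (lassoObj X (X *ᵥ βs + ε) l) b) :
    κ * sqNorm (X *ᵥ (b - βs)) ≤ 90 / 7 * n * l ^ 2 * A.card := by
  have hn : (0 : ℝ) < n := by exact_mod_cast h.n_pos
  have hκ := h.kappa_pos
  have hbasic := lasso_basic_inequality h.n_pos hl hA hε hmin
  set δ := b - βs
  set P := sqNorm (X *ᵥ δ)
  have hP : 0 ≤ P := sqNorm_nonneg _
  have hcone : ∑ j ∈ Aᶜ, |δ j| ≤ 3 * ∑ j ∈ A, |δ j| := by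
    have : 0 ≤ n * l * (3 * ∑ j ∈ A, |δ j| - ∑ j ∈ Aᶜ, |δ j|) := hP.trans hbasic
    have := nonneg_of_mul_nonneg_right this (by positivity)
    linarith
  have hre := h.restricted_eigenvalue δ hcone
  have hcs : (∑ j ∈ A, |δ j|) ^ 2 ≤ A.card * ∑ j ∈ A, δ j ^ 2 := by
    simpa using sq_sum_le_card_mul_sum_sq (s := A) (f := fun j => |δ j|)
  have h1 : P ≤ n * l * (3 * ∑ j ∈ A, |δ j|) := by
    refine hbasic.trans (mul_le_mul_of_nonneg_left ?_ (by positivity))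
    have : 0 ≤ ∑ j ∈ Aᶜ, |δ j| := Finset.sum_nonneg fun _ _ => abs_nonneg _
    linarith
  have h2 : P ^ 2 ≤ 9 * (n * l) ^ 2 * (A.card * ∑ j ∈ A, δ j ^ 2) := by
    have := pow_le_pow_left₀ hP h1 2
    have h' := mul_le_mul_of_nonneg_left hcs (show 0 ≤ 9 * (n * l) ^ 2 by positivity)
    calc P ^ 2 ≤ _ := this
      _ = 9 * (n * l) ^ 2 * (∑ j ∈ A, |δ j|) ^ 2 := by ring
      _ ≤ _ := h'
  rcases hP.eq_or_lt with h0 | h0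
  · rw [← h0, mul_zero]; positivity
  · have h3 : n * κ * P ^ 2 ≤ 9 * (n * l) ^ 2 * A.card * (10 / 7 * P) := by
      calc n * κ * P ^ 2 ≤ n * κ * (9 * (n * l) ^ 2 * (A.card * ∑ j ∈ A, δ j ^ 2)) := by gcongr
        _ = 9 * (n * l) ^ 2 * A.card * (10 / 7 * (7 / 10 * (n * κ) * ∑ j ∈ A, δ j ^ 2)) := by ring
        _ ≤ _ := by gcongr
    have h4 : (n * P) * (κ * P) ≤ (n * P) * (90 / 7 * n * l ^ 2 * A.card) := by
      linarith
    exact le_of_mul_le_mul_left h4 (by positivity)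

lemma lasso_sparsity (h : SparseDesign X A k κ η H) {βs b : Fin p → ℝ} {ε : Fin n → ℝ} {l : ℝ}
    (hl : 0 < l) (hA : supp βs = A) (hε : ∀ j, |(Xᵀ *ᵥ ε) j| ≤ n * (l / 2))
    (hmin : IsArgmin (lassoObj X (X *ᵥ βs + ε) l) b) :
    (supp b \ A).card < A.card * k := by
  by_contra! hcard
  have hn : (0 : ℝ) < n := by exact_mod_cast h.n_pos
  have hκ := h.kappa_pos
  have hq : (0 : ℝ) < A.card := by exact_mod_cast h.nonempty.card_pos
  have hk : (0 : ℝ) < k := by exact_mod_cast h.k_pos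
  obtain ⟨S, hS, hScard⟩ := Finset.exists_subset_card_eq hcard
  have hpred := h.lasso_prediction hl hA hε hmin
  have hgrad : ∀ j, (Xᵀ *ᵥ (X *ᵥ (b - βs))) j =
      (Xᵀ *ᵥ ε) j - (Xᵀ *ᵥ (X *ᵥ βs + ε - X *ᵥ b)) j := by
    intro j
    rw [← Pi.sub_apply, ← Matrix.mulVec_sub]
    congr 2
    rw [Matrix.mulVec_sub]; abel
  set g := Xᵀ *ᵥ (X *ᵥ (b - βs)) with hg
  set u := restrictTo S g
  have hlow : A.card * k * (n * (l / 2)) ^ 2 ≤ sqNorm u := by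
    rw [sqNorm_restrictTo]
    calc (A.card * k * (n * (l / 2)) ^ 2 : ℝ) = ∑ _j ∈ S, (n * (l / 2)) ^ 2 := by
          simp [hScard]
      _ ≤ _ := Finset.sum_le_sum fun j hj => ?_
    rw [← sq_abs (g j)]
    refine pow_le_pow_left₀ (by positivity) ?_ 2
    have hj' : b j ≠ 0 := mem_supp.1 (Finset.mem_sdiff.1 (hS hj)).1
    have h1 := lasso_le_abs_gradient h.n_pos hmin j (h.std j) hj'
    have h2 := hε j
    rw [hgrad j, abs_sub_comm]
    have := abs_sub_abs_le_abs_sub ((Xᵀ *ᵥ (X *ᵥ βs + ε - X *ᵥ b)) j) ((Xᵀ *ᵥ ε) j)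
    linarith
  have hself : sqNorm u = (X *ᵥ (b - βs)) ⬝ᵥ (X *ᵥ u) := by
    rw [← dotProduct_transpose_mulVec, ← hg, sqNorm_eq_dotProduct]
    refine Finset.sum_congr rfl fun j _ => ?_
    simp only [u, restrictTo]
    split_ifs <;> simp
  have hup : sqNorm (X *ᵥ u) ≤ n * κ * k / 364 * sqNorm u := by
    refine h.upper u ((Finset.card_union_le _ _).trans ?_)
    have : (supp u).card ≤ S.card := Finset.card_le_card (supp_restrictTo_subset S g)
    rw [mul_add, mul_one]; omega
  have hu0 : 0 < sqNorm u := lt_of_lt_of_le (by positivity) hlow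
  have h1 : sqNorm u ^ 2 ≤ sqNorm (X *ᵥ (b - βs)) * (n * κ * k / 364 * sqNorm u) := by
    nth_rewrite 1 [hself]
    exact (dotProduct_sq_le _ _).trans (mul_le_mul_of_nonneg_left hup (sqNorm_nonneg _))
  have h2 : sqNorm u * sqNorm u ≤ sqNorm u * (n * k / 364 * (90 / 7 * n * l ^ 2 * A.card)) := by
    calc sqNorm u * sqNorm u ≤ sqNorm u * (n * k / 364 * (κ * sqNorm (X *ᵥ (b - βs)))) := by
          linarith
      _ ≤ _ := by gcongr
  have h3 := le_of_mul_le_mul_left h2 hu0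
  have h4 : (0 : ℝ) < A.card * k * n ^ 2 * l ^ 2 := by positivity
  linarith

/-- The sup-norm error bound of the lasso. -/
lemma lasso_sup_norm (h : SparseDesign X A k κ η H) {βs b : Fin p → ℝ} {ε : Fin n → ℝ} {l : ℝ}
    (hl : 0 < l) (hA : supp βs = A) (hε : ∀ j, |(Xᵀ *ᵥ ε) j| ≤ n * (l / 2))
    (hmin : IsArgmin (lassoObj X (X *ᵥ βs + ε) l) b) (j : Fin p) :
    |b j - βs j| ≤ η * (3 / 2 * l) := by
  refine h.sup_le (b - βs) ?_ _ (fun j _ => ?_) j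
  · have hsub : supp (b - βs) ∪ A ⊆ supp b \ A ∪ A := by
      intro i hi
      by_cases hiA : i ∈ A
      · simp [hiA]
      · have hi' : i ∈ supp (b - βs) := by simpa [hiA] using hi
        have h0 : βs i = 0 := eq_zero_of_notMem_supp (by rwa [hA])
        rw [mem_supp, Pi.sub_apply, h0, sub_zero] at hi'
        simp [hiA, mem_supp, hi']
    refine (Finset.card_le_card hsub).trans ((Finset.card_union_le _ _).trans ?_)
    have := h.lasso_sparsity hl hA hε hmin
    rw [mul_add, mul_one]; omega
  · have h1 := lasso_abs_gradient_le h.n_pos hl hmin j (h.std j)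
    have h2 := hε j
    have h3 : (Xᵀ *ᵥ (X *ᵥ (b - βs))) j =
        (Xᵀ *ᵥ ε) j - (Xᵀ *ᵥ (X *ᵥ βs + ε - X *ᵥ b)) j := by
      rw [← Pi.sub_apply, ← Matrix.mulVec_sub]
      congr 2
      rw [Matrix.mulVec_sub]; abel
    rw [h3]
    refine (abs_sub _ _).trans ?_
    linarith

end SparseDesign
/-- The vector on all coordinates that equals `g` on `B` and vanishes elsewhere. -/
def extendZero {p : ℕ} (B : Finset (Fin p)) (g : B → ℝ) : Fin p → ℝ :=
  fun j => if h : j ∈ B then g ⟨j, h⟩ else 0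

lemma supp_extendZero_subset {p : ℕ} (B : Finset (Fin p)) (g : B → ℝ) :
    supp (extendZero B g) ⊆ B := by
  intro j hj
  by_contra h
  simp [supp, extendZero, h] at hj

lemma sum_extendZero {p : ℕ} (B : Finset (Fin p)) (g : B → ℝ) (f : Fin p → ℝ → ℝ)
    (hf : ∀ j, f j 0 = 0) : ∑ j, f j (extendZero B g j) = ∑ j : B, f j (g j) := by
  rw [← Finset.sum_subset (Finset.subset_univ B), ← Finset.sum_coe_sort]
  · simp [extendZero]
  · intro j _ hj
    simp [extendZero, hj, hf]

lemma mulVec_extendZero {n p : ℕ} (X : Matrix (Fin n) (Fin p) ℝ) (B : Finset (Fin p))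
    (g : B → ℝ) : X *ᵥ extendZero B g = cols X B *ᵥ g := by
  ext i
  exact sum_extendZero B g (fun j t => X i j * t) (by simp)

lemma sqNorm_extendZero {p : ℕ} (B : Finset (Fin p)) (g : B → ℝ) :
    sqNorm (extendZero B g) = sqNorm g :=
  sum_extendZero B g (fun _ t => t ^ 2) (by simp)

lemma extendZero_restrict {p : ℕ} {B : Finset (Fin p)} {w : Fin p → ℝ} (hw : supp w ⊆ B) :
    extendZero B (fun j => w j) = w := by
  ext j
  by_cases hj : j ∈ B
  · simp [extendZero, hj]
  · simp [extendZero, hj, eq_zero_of_notMem_supp (fun h => hj (hw h))]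

lemma sqNorm_eq_zero {ι : Type*} [Fintype ι] {v : ι → ℝ} (h : sqNorm v = 0) : v = 0 := by
  ext i
  have := (Finset.sum_eq_zero_iff_of_nonneg (fun i _ => sq_nonneg (v i))).1 h i (Finset.mem_univ i)
  simpa using this

lemma cols_transpose_mul_cols_mulVec {n p : ℕ} (X : Matrix (Fin n) (Fin p) ℝ)
    (B : Finset (Fin p)) (g : B → ℝ) (j : B) :
    (((cols X B)ᵀ * cols X B) *ᵥ g) j = (Xᵀ *ᵥ (X *ᵥ extendZero B g)) j := by
  rw [← Matrix.mulVec_mulVec, mulVec_extendZero]; rfl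

lemma dotProduct_cols_mulVec {n p : ℕ} (X : Matrix (Fin n) (Fin p) ℝ)
    (B : Finset (Fin p)) (g : B → ℝ) :
    g ⬝ᵥ (((cols X B)ᵀ * cols X B) *ᵥ g) = sqNorm (X *ᵥ extendZero B g) := by
  rw [← Matrix.mulVec_mulVec, dotProduct_transpose_mulVec, mulVec_extendZero, sqNorm_eq_dotProduct]

lemma isUnit_cols_transpose_mul_cols {n p : ℕ} (X : Matrix (Fin n) (Fin p) ℝ)
    (B : Finset (Fin p)) (h : ∀ w, supp w ⊆ B → X *ᵥ w = 0 → w = 0) :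
    IsUnit ((cols X B)ᵀ * cols X B) := by
  rw [← Matrix.mulVec_injective_iff_isUnit]
  intro v v' hv
  have hd : ((cols X B)ᵀ * cols X B) *ᵥ (v - v') = 0 := by
    rw [Matrix.mulVec_sub]; exact sub_eq_zero.2 hv
  have h0 := dotProduct_cols_mulVec X B (v - v')
  rw [hd, dotProduct_zero] at h0
  have h1 := h _ (supp_extendZero_subset B _) (sqNorm_eq_zero h0.symm)
  have h2 : sqNorm (v - v') = 0 := by rw [← sqNorm_extendZero, h1]; simp [sqNorm]
  exact sub_eq_zero.1 (sqNorm_eq_zero h2)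

lemma supp_oracle_subset {n p : ℕ} (X : Matrix (Fin n) (Fin p) ℝ) (A : Finset (Fin p))
    (y : Fin n → ℝ) : supp (oracle X A y) ⊆ A := supp_extendZero_subset A _

/-- The normal equations of the oracle estimator. -/
lemma oracle_normal_equations {n p : ℕ} {X : Matrix (Fin n) (Fin p) ℝ} {A : Finset (Fin p)}
    (h : ∀ w, supp w ⊆ A → X *ᵥ w = 0 → w = 0) (y : Fin n → ℝ) {j : Fin p} (hj : j ∈ A) :
    (Xᵀ *ᵥ (y - X *ᵥ oracle X A y)) j = 0 := by
  have hu := isUnit_cols_transpose_mul_cols X A h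
  have h1 := cols_transpose_mul_cols_mulVec X A
    (((cols X A)ᵀ * cols X A)⁻¹ *ᵥ ((cols X A)ᵀ *ᵥ y)) ⟨j, hj⟩
  rw [Matrix.mulVec_mulVec, Matrix.mul_nonsing_inv _ ((Matrix.isUnit_iff_isUnit_det _).1 hu),
    Matrix.one_mulVec] at h1
  rw [Matrix.mulVec_sub, Pi.sub_apply, sub_eq_zero]
  exact h1

namespace SparseDesign

variable {n p : ℕ} {X : Matrix (Fin n) (Fin p) ℝ} {A : Finset (Fin p)} {k : ℕ} {κ η H : ℝ}

lemma eq_zero_of_mulVec_eq_zero (h : SparseDesign X A k κ η H) {w : Fin p → ℝ} (hw : supp w ⊆ A)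
    (h0 : X *ᵥ w = 0) : w = 0 := by
  have hn : (0 : ℝ) < n := by exact_mod_cast h.n_pos
  have hκ := h.kappa_pos
  have h1 := h.lower w (by
    rw [Finset.union_eq_right.2 hw]; exact Nat.le_mul_of_pos_right _ (Nat.succ_pos _))
  rw [h0, show sqNorm (0 : Fin n → ℝ) = 0 by simp [sqNorm]] at h1
  have h2 := nonpos_of_mul_nonpos_right h1 (by positivity)
  exact sqNorm_eq_zero (le_antisymm h2 (sqNorm_nonneg _))

lemma oracle_sup_norm (h : SparseDesign X A k κ η H) {βs : Fin p → ℝ} {ε : Fin n → ℝ} {c : ℝ}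
    (hA : supp βs = A) (hε : ∀ j, |(Xᵀ *ᵥ ε) j| ≤ n * c) (j : Fin p) :
    |oracle X A (X *ᵥ βs + ε) j - βs j| ≤ η * c := by
  set o := oracle X A (X *ᵥ βs + ε)
  have hsub : supp (o - βs) ∪ A = A := by
    refine Finset.union_eq_right.2 fun i hi => ?_
    by_contra hiA
    have h1 : o i = 0 := eq_zero_of_notMem_supp fun h' => hiA (supp_oracle_subset _ _ _ h')
    have h2 : βs i = 0 := eq_zero_of_notMem_supp (by rwa [hA])
    simp [mem_supp, h1, h2] at hi
  refine h.sup_le (o - βs) ?_ _ (fun j hj => ?_) j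
  · rw [hsub]; exact Nat.le_mul_of_pos_right _ (Nat.succ_pos _)
  · rw [hsub] at hj
    have h1 := oracle_normal_equations (fun w => h.eq_zero_of_mulVec_eq_zero) (X *ᵥ βs + ε) hj
    have h2 : (Xᵀ *ᵥ (X *ᵥ (o - βs))) j = (Xᵀ *ᵥ ε) j := by
      have : X *ᵥ (o - βs) = ε - (X *ᵥ βs + ε - X *ᵥ o) := by rw [Matrix.mulVec_sub]; abel
      rw [this, Matrix.mulVec_sub, Pi.sub_apply, h1, sub_zero]
    rw [h2]; exact hε j

lemma oracle_gradient_le (h : SparseDesign X A k κ η H) {βs : Fin p → ℝ} {ε : Fin n → ℝ} {c : ℝ}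
    (hc : 0 ≤ c) (hA : supp βs = A) (hε : ∀ j, |(Xᵀ *ᵥ ε) j| ≤ n * c) (j : Fin p) :
    |(Xᵀ *ᵥ (X *ᵥ βs + ε - X *ᵥ oracle X A (X *ᵥ βs + ε))) j| ≤ n * (c * (1 + H * η)) := by
  set o := oracle X A (X *ᵥ βs + ε)
  have hsub : supp (o - βs) ⊆ A := fun i hi => by
    by_contra hiA
    have h1 : o i = 0 := eq_zero_of_notMem_supp fun h' => hiA (supp_oracle_subset _ _ _ h')
    have h2 : βs i = 0 := eq_zero_of_notMem_supp (by rwa [hA])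
    simp [mem_supp, h1, h2] at hi
  have h1 := h.row_le (o - βs) hsub (η * c) (mul_nonneg h.eta_nonneg hc)
    (fun j => h.oracle_sup_norm hA hε j) j
  have h2 : (Xᵀ *ᵥ (X *ᵥ βs + ε - X *ᵥ o)) j =
      (Xᵀ *ᵥ ε) j - (Xᵀ *ᵥ (X *ᵥ (o - βs))) j := by
    rw [← Pi.sub_apply, ← Matrix.mulVec_sub,
      show X *ᵥ βs + ε - X *ᵥ o = ε - X *ᵥ (o - βs) by rw [Matrix.mulVec_sub]; abel]
  rw [h2]
  refine (abs_sub _ _).trans ?_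
  have := hε j
  linarith

/-- On the event that all the noise correlations are small, both steps of the calibrated
algorithm are under control: its outcome is the oracle estimator, which identifies the model. -/
lemma eq_oracle_of_isCalibratedCCCP (h : SparseDesign X A k κ η H) {pen : ℝ → ℝ → ℝ} {a b : ℝ}
    (hpen : IsNonconvexPenalty pen a b) {βs : Fin p → ℝ} {ε : Fin n → ℝ} {τ l : ℝ}
    (hl : 0 < l) (hτ : 0 < τ) (hA : supp βs = A)
    (hε : ∀ j, |(Xᵀ *ᵥ ε) j| ≤ n * (τ * l / 2))
    (hτ₁ : η * (3 / 2 * τ) ≤ 1 / 4) (hτ₂ : η * (3 / 2 * τ) ≤ b) (hτ₃ : τ / 2 * (1 + H * η) ≤ 1 / 4)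
    (hsig : ∀ j ∈ A, (a + 1) * l ≤ |βs j|) {β : Fin p → ℝ}
    (hβ : IsCalibratedCCCP pen X (X *ᵥ βs + ε) τ l β) :
    β = oracle X A (X *ᵥ βs + ε) ∧ supp (oracle X A (X *ᵥ βs + ε)) = A := by
  have hn : (0 : ℝ) < n := by exact_mod_cast h.n_pos
  have ha := hpen.one_lt_a
  have hη := h.eta_nonneg
  obtain ⟨β₁, hβ₁, hβ⟩ := hβ
  have hτl : 0 < τ * l := mul_pos hτ hl
  have hgrad0 : gradJ pen (τ * l) 0 = 0 := by
    have := hpen.grad_small (τ * l) hτl 0 (by simpa using (mul_pos hpen.b_pos hτl).le)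
    simpa using this
  have hlasso : IsArgmin (lassoObj X (X *ᵥ βs + ε) (τ * l)) β₁ := by
    intro b'
    have := hβ₁ b'
    simpa [Qfun, lassoObj, hgrad0] using this
  have hfirst : ∀ j, |β₁ j - βs j| ≤ η * (3 / 2 * (τ * l)) :=
    h.lasso_sup_norm hτl hA hε hlasso
  have hora := h.oracle_sup_norm hA hε
  have hogr := h.oracle_gradient_le (by positivity) hA hε
  set y := X *ᵥ βs + ε
  set o := oracle X A y
  have hsmall : η * (3 / 2 * (τ * l)) ≤ l / 4 := by nlinarith
  have hsmall' : η * (3 / 2 * (τ * l)) ≤ b * l := by nlinarith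
  have hosmall : η * (τ * l / 2) ≤ l / 4 := by
    have : 0 ≤ η * (τ * l) := by positivity
    linarith
  have hsign : ∀ j ∈ A, (o j ≠ 0) ∧ a * l < |β₁ j| ∧ Real.sign (β₁ j) = Real.sign (o j) := by
    intro j hj
    have h1 := (abs_le.1 ((hfirst j).trans hsmall))
    have h2 := (abs_le.1 ((hora j).trans hosmall))
    have h3 := hsig j hj
    have hal : l < a * l := by nlinarith
    rcases le_total 0 (βs j) with hpos | hneg
    · rw [abs_of_nonneg hpos] at h3
      have e1 : 0 < β₁ j := by linarith
      have e2 : 0 < o j := by linarith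
      refine ⟨e2.ne', ?_, by rw [Real.sign_of_pos e1, Real.sign_of_pos e2]⟩
      rw [abs_of_pos e1]; linarith
    · rw [abs_of_nonpos hneg] at h3
      have e1 : β₁ j < 0 := by linarith
      have e2 : o j < 0 := by linarith
      refine ⟨e2.ne, ?_, by rw [Real.sign_of_neg e1, Real.sign_of_neg e2]⟩
      rw [abs_of_neg e1]; linarith
  have hzero : ∀ j ∉ A, o j = 0 := fun j hj =>
    eq_zero_of_notMem_supp fun h' => hj (supp_oracle_subset _ _ _ h')
  refine ⟨?_, Finset.Subset.antisymm (supp_oracle_subset _ _ _)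
    fun j hj => mem_supp.2 (hsign j hj).1⟩
  -- compare the criterion at `β` and at the oracle
  have hQ := hβ o
  have hexp := sqNorm_response_sub X y o (β - o)
  rw [add_sub_cancel] at hexp
  have hterm : ∀ j, -((β - o) j * ((Xᵀ *ᵥ (y - X *ᵥ o)) j / n)) +
      (gradJ pen l (β₁ j) * β j + l * |β j| - (gradJ pen l (β₁ j) * o j + l * |o j|)) ≥
      if j ∈ A then 0 else l / 2 * |β j| := by
    intro j
    split_ifs with hj
    · rw [oracle_normal_equations (fun w => h.eq_zero_of_mulVec_eq_zero) y hj]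
      obtain ⟨h1, h2, h3⟩ := hsign j hj
      rw [hpen.grad_large l hl _ h2, h3]
      have e1 : Real.sign (o j) * o j = |o j| := by
        rcases lt_or_gt_of_ne h1 with h' | h'
        · rw [Real.sign_of_neg h', abs_of_neg h']; ring
        · rw [Real.sign_of_pos h', abs_of_pos h']; ring
      have e2 : Real.sign (o j) * β j ≤ |β j| := by
        rcases lt_or_gt_of_ne h1 with h' | h'
        · rw [Real.sign_of_neg h']; linarith [neg_abs_le (β j)]
        · rw [Real.sign_of_pos h']; linarith [le_abs_self (β j)]
      have e3 := mul_le_mul_of_nonneg_left e2 hl.le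
      have e4 : -l * Real.sign (o j) * o j = -(l * |o j|) := by rw [mul_assoc, e1]; ring
      rw [e4]
      simp only [zero_div, mul_zero]
      linarith
    · have hβs : βs j = 0 := eq_zero_of_notMem_supp (by rwa [hA])
      have h1 := hfirst j
      rw [hβs, sub_zero] at h1
      have h2 := (hpen.grad_small l hl (β₁ j) (h1.trans hsmall')).trans (h1.trans hsmall)
      have h3 : |(Xᵀ *ᵥ (y - X *ᵥ o)) j / n| ≤ l / 4 := by
        rw [abs_div, abs_of_pos hn, div_le_iff₀ hn]
        refine (hogr j).trans ?_
        have : τ * l / 2 * (1 + H * η) ≤ l / 4 := by nlinarith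
        rw [mul_comm]; gcongr
      rw [Pi.sub_apply, hzero j hj]
      have e1 : |β j * ((Xᵀ *ᵥ (y - X *ᵥ o)) j / n)| ≤ |β j| * (l / 4) := by
        rw [abs_mul]; gcongr
      have e2 : |gradJ pen l (β₁ j) * β j| ≤ l / 4 * |β j| := by
        rw [abs_mul]; gcongr
      have e1' := (abs_le.1 e1).2
      have e2' := (abs_le.1 e2).1
      simp only [sub_zero, abs_zero, mul_zero]
      linarith
  have hsum := Finset.sum_le_sum fun j (_ : j ∈ Finset.univ) => hterm j
  have hdot : ∑ j, (β - o) j * ((Xᵀ *ᵥ (y - X *ᵥ o)) j / n) =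
      1 / n * ((β - o) ⬝ᵥ (Xᵀ *ᵥ (y - X *ᵥ o))) := by
    simp only [dotProduct, Finset.mul_sum]
    exact Finset.sum_congr rfl fun j _ => by ring
  simp only [Finset.sum_add_distrib, Finset.sum_neg_distrib, Finset.sum_sub_distrib, hdot,
    ← Finset.mul_sum] at hsum
  unfold Qfun at hQ
  rw [hexp] at hQ
  have e1 : 1 / (2 * (n : ℝ)) * (sqNorm (y - X *ᵥ o) -
      2 * ((β - o) ⬝ᵥ (Xᵀ *ᵥ (y - X *ᵥ o))) + sqNorm (X *ᵥ (β - o))) =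
      1 / (2 * (n : ℝ)) * sqNorm (y - X *ᵥ o) -
      1 / n * ((β - o) ⬝ᵥ (Xᵀ *ᵥ (y - X *ᵥ o))) + 1 / (2 * (n : ℝ)) * sqNorm (X *ᵥ (β - o)) := by
    field_simp
  rw [e1] at hQ
  have hnn : ∀ j, 0 ≤ if j ∈ A then 0 else l / 2 * |β j| := fun j => by
    split_ifs <;> positivity
  have hnn' := Finset.sum_nonneg fun j (_ : j ∈ Finset.univ) => hnn j
  have hX0 : 0 ≤ 1 / (2 * (n : ℝ)) * sqNorm (X *ᵥ (β - o)) :=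
    mul_nonneg (by positivity) (sqNorm_nonneg _)
  have hS0 : ∑ j, (if j ∈ A then 0 else l / 2 * |β j|) = 0 := by linarith
  have hX00 : sqNorm (X *ᵥ (β - o)) = 0 := by
    have : 1 / (2 * (n : ℝ)) * sqNorm (X *ᵥ (β - o)) = 0 := by linarith
    rcases mul_eq_zero.1 this with h' | h'
    · have : 0 < 1 / (2 * (n : ℝ)) := by positivity
      linarith
    · exact h'
  have hsub : supp (β - o) ⊆ A := by
    intro j hj
    by_contra hjA
    have := (Finset.sum_eq_zero_iff_of_nonneg fun j _ => hnn j).1 hS0 j (Finset.mem_univ j)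
    rw [if_neg hjA] at this
    have hβ0 : β j = 0 := by
      rcases mul_eq_zero.1 this with h' | h'
      · linarith
      · exact abs_eq_zero.1 h'
    simp [mem_supp, hβ0, hzero j hjA] at hj
  exact sub_eq_zero.1 (h.eq_zero_of_mulVec_eq_zero hsub (sqNorm_eq_zero hX00))

end SparseDesign
/-! ### Sparse eigenvalues -/

section Spectrum

variable {ι : Type*} [Fintype ι] [DecidableEq ι]

lemma mul_sqNorm_le_of_le_lamMin {M : Matrix ι ι ℝ} (hM : M.IsHermitian) {c : ℝ}
    (hc : c ≤ lamMin M) (v : ι → ℝ) : c * sqNorm v ≤ v ⬝ᵥ (M *ᵥ v) := by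
  have hps : (M - algebraMap ℝ (Matrix ι ι ℝ) c).PosSemidef := by
    rw [Matrix.posSemidef_iff_isHermitian_and_spectrum_nonneg]
    refine ⟨hM.sub (by simp [Matrix.algebraMap_eq_diagonal]), ?_⟩
    rw [← spectrum.sub_singleton_eq, Set.sub_singleton]
    rintro _ ⟨x, hx, rfl⟩
    have : sInf (spectrum ℝ M) ≤ x := csInf_le (Matrix.finite_real_spectrum (A := M)).bddBelow hx
    have h2 : c ≤ x := hc.trans this
    simpa using h2
  have h := (Matrix.posSemidef_iff_dotProduct_mulVec.1 hps).2 v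
  rw [Matrix.sub_mulVec, dotProduct_sub, Algebra.algebraMap_eq_smul_one, Matrix.smul_mulVec,
    Matrix.one_mulVec, dotProduct_smul] at h
  rw [sqNorm_eq_dotProduct]
  simpa using h

lemma le_mul_sqNorm_of_lamMax_le {M : Matrix ι ι ℝ} (hM : M.IsHermitian) {c : ℝ}
    (hc : lamMax M ≤ c) (v : ι → ℝ) : v ⬝ᵥ (M *ᵥ v) ≤ c * sqNorm v := by
  have hps : (algebraMap ℝ (Matrix ι ι ℝ) c - M).PosSemidef := by
    rw [Matrix.posSemidef_iff_isHermitian_and_spectrum_nonneg]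
    refine ⟨Matrix.IsHermitian.sub
      (by simp [Matrix.algebraMap_eq_diagonal]) hM, ?_⟩
    rw [← spectrum.singleton_sub_eq, Set.singleton_sub]
    rintro _ ⟨x, hx, rfl⟩
    have : x ≤ sSup (spectrum ℝ M) := le_csSup (Matrix.finite_real_spectrum (A := M)).bddAbove hx
    have h2 : x ≤ c := this.trans hc
    simpa using h2
  have h := (Matrix.posSemidef_iff_dotProduct_mulVec.1 hps).2 v
  rw [Matrix.sub_mulVec, dotProduct_sub, Algebra.algebraMap_eq_smul_one, Matrix.smul_mulVec,
    Matrix.one_mulVec, dotProduct_smul] at h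
  rw [sqNorm_eq_dotProduct]
  simpa using h

end Spectrum

lemma sum_abs_le_opNormOne {ι : Type*} [Fintype ι] (M : Matrix ι ι ℝ) (i : ι) : ∑ j, |M i j| ≤ opNormOne M :=
  le_ciSup (f := fun i => ∑ j, |M i j|) (Set.finite_range _).bddAbove i

lemma abs_mulVec_le {ι : Type*} [Fintype ι] (M : Matrix ι ι ℝ) (v : ι → ℝ) {c : ℝ} (hv : ∀ j, |v j| ≤ c) (i : ι) :
    |(M *ᵥ v) i| ≤ opNormOne M * c := by
  refine (abs_dotProduct_le (M i) v hv).trans ?_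
  rw [mul_comm]
  have hc : 0 ≤ c := (abs_nonneg _).trans (hv i)
  exact mul_le_mul_of_nonneg_right (sum_abs_le_opNormOne M i) hc

variable {n p : ℕ} {X : Matrix (Fin n) (Fin p) ℝ} {A : Finset (Fin p)}

lemma isHermitian_gram (X : Matrix (Fin n) (Fin p) ℝ) (B : Finset (Fin p)) :
    (gram X B).IsHermitian := by
  rw [Matrix.IsHermitian, Matrix.conjTranspose_eq_transpose_of_trivial]
  simp [gram, Matrix.transpose_smul, Matrix.transpose_mul]

lemma dotProduct_gram_mulVec (X : Matrix (Fin n) (Fin p) ℝ) {B : Finset (Fin p)} {w : Fin p → ℝ}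
    (hw : supp w ⊆ B) :
    (fun j : B => w j) ⬝ᵥ (gram X B *ᵥ fun j => w j) = (n : ℝ)⁻¹ * sqNorm (X *ᵥ w) := by
  rw [gram, Matrix.smul_mulVec, dotProduct_smul, dotProduct_cols_mulVec, extendZero_restrict hw,
    smul_eq_mul]

lemma sqNorm_coe {B : Finset (Fin p)} {w : Fin p → ℝ} (hw : supp w ⊆ B) :
    sqNorm (fun j : B => w j) = sqNorm w := by
  rw [← sqNorm_extendZero, extendZero_restrict hw]

lemma gram_mulVec (X : Matrix (Fin n) (Fin p) ℝ) {B : Finset (Fin p)} {w : Fin p → ℝ}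
    (hw : supp w ⊆ B) (j : B) :
    (gram X B *ᵥ fun j => w j) j = (n : ℝ)⁻¹ * (Xᵀ *ᵥ (X *ᵥ w)) j := by
  rw [gram, Matrix.smul_mulVec, Pi.smul_apply, cols_transpose_mul_cols_mulVec,
    extendZero_restrict hw, smul_eq_mul]

lemma le_sqNorm_mulVec_of_le_xiMin {κ m : ℝ} (hn : 0 < n) (hκ : κ ≤ xiMin X A m) {w : Fin p → ℝ}
    (hm : ((supp w ∪ A).card : ℝ) ≤ m) : n * κ * sqNorm w ≤ sqNorm (X *ᵥ w) := by
  have hn' : (0 : ℝ) < n := by exact_mod_cast hn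
  have hB : κ ≤ lamMin (gram X (supp w ∪ A)) :=
    hκ.trans (csInf_le ((Set.toFinite _).bddBelow) ⟨_, ⟨hm, Finset.subset_union_right⟩, rfl⟩)
  have h := mul_sqNorm_le_of_le_lamMin (isHermitian_gram X _) hB (fun j => w j)
  rw [dotProduct_gram_mulVec X Finset.subset_union_left, sqNorm_coe Finset.subset_union_left,
    inv_mul_eq_div, le_div_iff₀ hn'] at h
  linarith

lemma sqNorm_mulVec_le_xiMax {m : ℝ} (hn : 0 < n) {w : Fin p → ℝ}
    (hm : ((supp w ∪ A).card : ℝ) ≤ m) : sqNorm (X *ᵥ w) ≤ n * xiMax X A m * sqNorm w := by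
  have hn' : (0 : ℝ) < n := by exact_mod_cast hn
  have hB : lamMax (gram X (supp w ∪ A)) ≤ xiMax X A m :=
    le_csSup ((Set.toFinite _).bddAbove) ⟨_, ⟨hm, Finset.subset_union_right⟩, rfl⟩
  have h := le_mul_sqNorm_of_lamMax_le (isHermitian_gram X _) hB (fun j => w j)
  rw [dotProduct_gram_mulVec X Finset.subset_union_left, sqNorm_coe Finset.subset_union_left,
    inv_mul_eq_div, div_le_iff₀ hn'] at h
  linarith

lemma opNormOne_nonneg {ι : Type*} [Fintype ι] (M : Matrix ι ι ℝ) : 0 ≤ opNormOne M :=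
  Real.iSup_nonneg fun _ => Finset.sum_nonneg fun _ _ => abs_nonneg _

/-- The sparse Riesz type condition forces `ξ_max / (α κ_min)` to be small. -/
lemma ratio_le {ξ α κ : ℝ} (hα : 0 < α) (hκ : 0 < κ) (hξ : 0 ≤ ξ)
    (h : ξ / α ≤ 1 / 576 * κ * (1 - 3 * √(ξ / (α * κ))) ^ 2) : 729 * ξ ≤ α * κ := by
  set x := √(ξ / (α * κ)) with hx
  have hx0 : 0 ≤ x := Real.sqrt_nonneg _
  have hx2 : x ^ 2 = ξ / (α * κ) := Real.sq_sqrt (by positivity)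
  have h1 : ξ / α = κ * x ^ 2 := by rw [hx2]; field_simp
  rw [h1] at h
  have h2 : (24 * x) ^ 2 ≤ (1 - 3 * x) ^ 2 := by
    have : κ * (576 * x ^ 2) ≤ κ * (1 - 3 * x) ^ 2 := by linarith
    have := le_of_mul_le_mul_left this hκ
    linarith
  have h3 : 27 * x ≤ 1 := by
    rcases abs_cases (1 - 3 * x) with ⟨h', _⟩ | ⟨h', _⟩ <;>
      linarith [sq_le_sq.1 h2, abs_of_nonneg (show 0 ≤ 24 * x by linarith)]
  have h4 : 729 * x ^ 2 ≤ 1 := by nlinarith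
  rw [hx2, ← mul_div_assoc, div_le_one (by positivity)] at h4
  exact h4

/-- The assumptions on the design imply the sparse eigenvalue and sup-norm bounds. -/
lemma sparseDesign_of_assumptions {α κ ηmax ηmin : ℝ} (hA : A.Nonempty)
    (hstd : ∀ j, (∑ i, X i j ^ 2) / (n : ℝ) = 1) (hα : 1 ≤ α) (hκ : 0 < κ)
    (hmin : κ ≤ xiMin X A ((α + 1) * A.card))
    (hmax : xiMax X A (α * A.card) / α ≤
      1 / 576 * κ * (1 - 3 * √(xiMax X A (α * A.card) / (α * κ))) ^ 2)
    (hzmax : zetaMax X A ((α + 1) * A.card) ≤ ηmax)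
    (hzmin : zetaMin X A ((α + 1) * A.card) ≤ ηmin) :
    SparseDesign X A (⌊α⌋₊ - 1) κ ηmin ηmax := by
  obtain ⟨j₀, hj₀⟩ := hA
  have hA : A.Nonempty := ⟨j₀, hj₀⟩
  have hn' : (n : ℝ) ≠ 0 := fun h0 => by simpa [h0] using hstd j₀
  have hn : 0 < n := Nat.pos_of_ne_zero fun h => hn' (by simp [h])
  have hn0 : (0 : ℝ) < n := by exact_mod_cast hn
  have hq : (1 : ℝ) ≤ A.card := by exact_mod_cast hA.card_pos
  have hstd' : ∀ j, ∑ i, X i j ^ 2 = n := fun j => by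
    have := hstd j; rwa [div_eq_one_iff_eq hn'] at this
  set w₀ : Fin p → ℝ := Pi.single j₀ 1
  have hw₀ : supp w₀ ∪ A = A := by
    refine Finset.union_eq_right.2 fun i hi => ?_
    by_contra hiA
    have : i ≠ j₀ := fun h => hiA (h ▸ hj₀)
    simp [w₀, mem_supp, this] at hi
  have hsq₀ : sqNorm w₀ = 1 := by simp [sqNorm, w₀, Pi.single_apply, ite_pow]
  have hX₀ : sqNorm (X *ᵥ w₀) = n := by
    rw [← hstd' j₀]; simp [sqNorm, w₀, Matrix.mulVec_single]
  set ξ := xiMax X A (α * A.card)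
  have hξ : 1 ≤ ξ := by
    have := sqNorm_mulVec_le_xiMax (X := X) (A := A) (m := α * A.card) hn (w := w₀)
      (by rw [hw₀]; nlinarith)
    rw [hX₀, hsq₀, mul_one] at this
    exact le_of_mul_le_mul_left (by linarith) hn0
  have hκ1 : κ ≤ 1 := by
    have := le_sqNorm_mulVec_of_le_xiMin hn hmin (w := w₀) (by rw [hw₀]; nlinarith)
    rw [hX₀, hsq₀, mul_one] at this
    exact le_of_mul_le_mul_left (by linarith) hn0
  have hratio := ratio_le (by linarith) hκ (by linarith) hmax
  have hα729 : 729 ≤ α := by nlinarith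
  have hfl : 729 ≤ ⌊α⌋₊ := Nat.le_floor (by exact_mod_cast hα729)
  have hfl' : (⌊α⌋₊ : ℝ) ≤ α := Nat.floor_le (by linarith)
  have hfl'' : α < ⌊α⌋₊ + 1 := Nat.lt_floor_add_one α
  have hk : ((⌊α⌋₊ - 1 : ℕ) : ℝ) = ⌊α⌋₊ - 1 := by
    rw [Nat.cast_sub (by omega)]; simp
  have hk2 : α ≤ 2 * ((⌊α⌋₊ - 1 : ℕ) : ℝ) := by rw [hk]; linarith
  have hcard : ∀ B : Finset (Fin p), B.card ≤ A.card * (⌊α⌋₊ - 1 + 1) →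
      (B.card : ℝ) ≤ α * A.card := fun B hB => by
    rw [Nat.sub_add_cancel (by omega)] at hB
    calc (B.card : ℝ) ≤ A.card * ⌊α⌋₊ := by exact_mod_cast hB
      _ ≤ α * A.card := by rw [mul_comm]; gcongr
  have hcard' : ∀ B : Finset (Fin p), B.card ≤ A.card * (⌊α⌋₊ - 1 + 1) →
      (B.card : ℝ) ≤ (α + 1) * A.card := fun B hB => by linarith [hcard B hB]
  have hlow : ∀ w, (supp w ∪ A).card ≤ A.card * (⌊α⌋₊ - 1 + 1) →
      n * κ * sqNorm w ≤ sqNorm (X *ᵥ w) := fun w hw =>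
    le_sqNorm_mulVec_of_le_xiMin hn hmin (hcard' _ hw)
  refine ⟨hn, hA, by omega, hκ, ?_, hstd', hlow, ?_, ?_, ?_⟩
  · refine (opNormOne_nonneg (gram X A)⁻¹).trans (le_trans ?_ hzmin)
    refine le_csSup (Set.toFinite _).bddAbove ⟨A, ⟨?_, subset_rfl⟩, rfl⟩
    nlinarith
  · intro w hw
    refine (sqNorm_mulVec_le_xiMax hn (hcard _ hw)).trans ?_
    have : ξ ≤ κ * ((⌊α⌋₊ - 1 : ℕ) : ℝ) / 364 := by
      rw [le_div_iff₀ (by norm_num)]; nlinarith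
    calc n * ξ * sqNorm w ≤ n * (κ * ((⌊α⌋₊ - 1 : ℕ) : ℝ) / 364) * sqNorm w := by
          have := sqNorm_nonneg w
          gcongr
      _ = _ := by ring
  · intro w hw c hc j
    by_cases hj : j ∈ supp w ∪ A
    · set B := supp w ∪ A
      have hwB : supp w ⊆ B := Finset.subset_union_left
      have hu : IsUnit (gram X B) := by
        have h1 : IsUnit ((cols X B)ᵀ * cols X B) := by
          refine isUnit_cols_transpose_mul_cols X B fun v hv hv0 => ?_
          have h2 := hlow v ((Finset.card_le_card
            (Finset.union_subset hv Finset.subset_union_right)).trans hw)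
          rw [hv0, show sqNorm (0 : Fin n → ℝ) = 0 by simp [sqNorm]] at h2
          exact sqNorm_eq_zero (le_antisymm (nonpos_of_mul_nonpos_right h2 (by positivity))
            (sqNorm_nonneg _))
        rw [Matrix.isUnit_iff_isUnit_det] at h1 ⊢
        rw [gram, Matrix.det_smul]
        exact (IsUnit.mk0 _ (by positivity)).mul h1
      have h1 : (gram X B)⁻¹ *ᵥ (gram X B *ᵥ fun j => w j) = fun j : B => w j := by
        rw [Matrix.mulVec_mulVec, Matrix.nonsing_inv_mul _
          ((Matrix.isUnit_iff_isUnit_det _).1 hu), Matrix.one_mulVec]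
      have h2 := abs_mulVec_le (gram X B)⁻¹ (gram X B *ᵥ fun j => w j) (c := c) (fun i => by
        rw [gram_mulVec X hwB, abs_mul, abs_of_pos (by positivity), inv_mul_eq_div,
          div_le_iff₀ hn0, mul_comm]
        exact hc i i.2) ⟨j, hj⟩
      rw [h1] at h2
      have hc0 : 0 ≤ c := by
        have := (abs_nonneg _).trans (hc j hj)
        exact nonneg_of_mul_nonneg_right this hn0
      refine h2.trans (mul_le_mul_of_nonneg_right (le_trans ?_ hzmin) hc0)
      exact le_csSup (Set.toFinite _).bddAbove
        ⟨B, ⟨hcard' _ hw, Finset.subset_union_right⟩, rfl⟩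
    · rw [eq_zero_of_notMem_supp fun h => hj (Finset.mem_union_left _ h), abs_zero]
      have hc0 : 0 ≤ c := by
        have := (abs_nonneg _).trans (hc j₀ (Finset.mem_union_right _ hj₀))
        exact nonneg_of_mul_nonneg_right this hn0
      refine mul_nonneg ((opNormOne_nonneg (gram X A)⁻¹).trans (le_trans ?_ hzmin)) hc0
      refine le_csSup (Set.toFinite _).bddAbove ⟨A, ⟨?_, subset_rfl⟩, rfl⟩
      nlinarith
  · intro w hw c hc hwc j
    set B := insert j A
    have hwB : supp w ⊆ B := hw.trans (Finset.subset_insert _ _)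
    have h2 := abs_mulVec_le (gram X B) (fun j => w j) (c := c) (fun i => hwc i)
      ⟨j, Finset.mem_insert_self _ _⟩
    rw [gram_mulVec X hwB, abs_mul, abs_of_pos (by positivity), inv_mul_eq_div,
      div_le_iff₀ hn0, mul_comm] at h2
    refine h2.trans (mul_le_mul_of_nonneg_left (mul_le_mul_of_nonneg_right (le_trans ?_ hzmax) hc)
      hn0.le)
    refine le_csSup (Set.toFinite _).bddAbove ⟨B, ⟨?_, Finset.subset_insert _ _⟩, rfl⟩
    have : (B.card : ℝ) ≤ A.card + 1 := by exact_mod_cast Finset.card_insert_le j A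
    nlinarith

/-! ### Tail bounds for linear forms of the noise -/

section Noise

variable {n : ℕ} {Ω : Type*} [MeasurableSpace Ω] {μ : Measure Ω} {ε : Fin n → Ω → ℝ} {σ : ℝ≥0}

lemma IsSubgaussianNoise.hasSubgaussianMGF_dotProduct (h : IsSubgaussianNoise μ ε σ)
    (u : Fin n → ℝ) :
    HasSubgaussianMGF (fun ω => u ⬝ᵥ fun i => ε i ω) ((sqNorm u).toNNReal * σ ^ 2) μ := by
  have hind : iIndepFun (fun i ω => u i * ε i ω) μ :=
    h.indep.comp (fun i x => u i * x) fun i => measurable_const_mul (u i)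
  have hs := HasSubgaussianMGF.sum_of_iIndepFun hind (s := Finset.univ)
    (c := fun i => (u i ^ 2).toNNReal * σ ^ 2) fun i _ => by
      rw [Real.toNNReal_of_nonneg (sq_nonneg _)]
      exact (h.subgaussian i).const_mul (u i)
  rwa [← Finset.sum_mul, ← Real.toNNReal_sum_of_nonneg fun i _ => sq_nonneg _] at hs

variable [IsProbabilityMeasure μ]

lemma IsSubgaussianNoise.measureReal_abs_dotProduct_gt_le (h : IsSubgaussianNoise μ ε σ)
    (u : Fin n → ℝ) {c : ℝ} (hc : 0 ≤ c) :
    μ.real {ω | c < |u ⬝ᵥ fun i => ε i ω|} ≤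
      2 * Real.exp (-c ^ 2 / (2 * (sqNorm u * (σ : ℝ) ^ 2))) := by
  have h1 := (h.hasSubgaussianMGF_dotProduct u).measure_ge_le hc
  have h2 := (h.hasSubgaussianMGF_dotProduct u).neg.measure_ge_le hc
  push_cast at h1 h2
  have hsub : {ω | c < |u ⬝ᵥ fun i => ε i ω|} ⊆
      {ω | c ≤ u ⬝ᵥ fun i => ε i ω} ∪ {ω | c ≤ (-fun ω => u ⬝ᵥ fun i => ε i ω) ω} := by
    intro ω hω
    rcases lt_abs.1 (show c < |u ⬝ᵥ fun i => ε i ω| from hω) with h' | h'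
    · exact Or.inl h'.le
    · exact Or.inr h'.le
  have h3 := (measureReal_mono hsub (μ := μ)).trans (measureReal_union_le _ _)
  rw [Real.coe_toNNReal _ (sqNorm_nonneg u)] at h1 h2
  linarith

/-- The maximal noise correlation. -/
lemma IsSubgaussianNoise.measureReal_exists_correlation_gt_le (h : IsSubgaussianNoise μ ε σ)
    {p : ℕ} {X : Matrix (Fin n) (Fin p) ℝ} (hn : 0 < n) (hstd : ∀ j, ∑ i, X i j ^ 2 = n) {t : ℝ}
    (ht : 0 ≤ t) :
    μ.real {ω | ∃ j, n * (t / 2) < |(Xᵀ *ᵥ fun i => ε i ω) j|} ≤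
      2 * p * Real.exp (-(n * t ^ 2) / (8 * (σ : ℝ) ^ 2)) := by
  have hn' : (0 : ℝ) < n := by exact_mod_cast hn
  have hset : {ω | ∃ j, n * (t / 2) < |(Xᵀ *ᵥ fun i => ε i ω) j|} =
      ⋃ j, {ω | n * (t / 2) < |(fun i => X i j) ⬝ᵥ fun i => ε i ω|} := by
    ext ω; simp [Matrix.mulVec, Matrix.transpose_apply]
  rw [hset]
  refine (measureReal_iUnion_fintype_le _).trans ?_
  calc ∑ j, μ.real {ω | n * (t / 2) < |(fun i => X i j) ⬝ᵥ fun i => ε i ω|}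
      ≤ ∑ _j : Fin p, 2 * Real.exp (-(n * t ^ 2) / (8 * (σ : ℝ) ^ 2)) := by
        refine Finset.sum_le_sum fun j _ => ?_
        refine (h.measureReal_abs_dotProduct_gt_le _ (by positivity)).trans (le_of_eq ?_)
        have : sqNorm (fun i => X i j) = n := hstd j
        rw [this]
        congr 2
        by_cases hσ : (σ : ℝ) = 0
        · simp [hσ]
        · field_simp; ring
    _ = _ := by simp; ring

lemma one_sub_le_prob {E B : Set Ω} (h : Eᶜ ⊆ B) : 1 - μ.real B ≤ prob μ E :=
  sub_le_sub_left (measureReal_mono h) 1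

end Noise

lemma prob_le_one {Ω : Type*} [MeasurableSpace Ω] {μ : Measure Ω} (E : Set Ω) : prob μ E ≤ 1 := by
  have : 0 ≤ μ.real Eᶜ := measureReal_nonneg
  unfold prob; linarith

lemma tendsto_prob_of_compl_subset {Ω : ℕ → Type*} [∀ n, MeasurableSpace (Ω n)]
    {μ : (n : ℕ) → Measure (Ω n)} [∀ n, IsProbabilityMeasure (μ n)] {E B : (n : ℕ) → Set (Ω n)}
    (h : ∀ᶠ n in atTop, (E n)ᶜ ⊆ B n) (hB : Tendsto (fun n => (μ n).real (B n)) atTop (𝓝 0)) :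
    Tendsto (fun n => prob (μ n) (E n)) atTop (𝓝 1) := by
  have h1 : Tendsto (fun n => 1 - (μ n).real (B n)) atTop (𝓝 1) := by
    simpa using hB.const_sub 1
  exact tendsto_of_tendsto_of_tendsto_of_le_of_le' h1 tendsto_const_nhds
    (h.mono fun n hn => one_sub_le_prob hn) (Eventually.of_forall fun n => prob_le_one _)

lemma tendsto_mul_exp_neg_zero {p : ℕ → ℕ} {u : ℕ → ℝ} (hp : ∀ᶠ n in atTop, 0 < p n)
    (hu : Tendsto u atTop atTop) (hlog : (fun n => Real.log (p n)) =o[atTop] u) {s : ℝ}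
    (hs : 0 < s) : Tendsto (fun n => (p n : ℝ) * Real.exp (-(u n) / s)) atTop (𝓝 0) := by
  have h1 : Tendsto (fun n => Real.exp (-(u n / (2 * s)))) atTop (𝓝 0) :=
    Real.tendsto_exp_neg_atTop_nhds_zero.comp (hu.atTop_div_const (by positivity))
  refine squeeze_zero' (Eventually.of_forall fun n => by positivity) ?_ h1
  filter_upwards [hp, hu.eventually_ge_atTop 0,
    hlog.bound (show 0 < 1 / (2 * s) by positivity)] with n hpn hun hn
  have hp0 : (0 : ℝ) < p n := by exact_mod_cast hpn
  rw [Real.norm_of_nonneg hun] at hn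
  have h2 : Real.log (p n) ≤ u n / (2 * s) := by
    refine (Real.le_norm_self _).trans (hn.trans (le_of_eq ?_)); ring
  calc (p n : ℝ) * Real.exp (-(u n) / s) = Real.exp (Real.log (p n) + -(u n) / s) := by
        rw [Real.exp_add, Real.exp_log hp0]
    _ ≤ _ := by
        rw [Real.exp_le_exp]
        have : -(u n) / s = -(u n / (2 * s)) - u n / (2 * s) := by field_simp; ring
        linarith

lemma minSignal_nonneg {p : ℕ} (v : Fin p → ℝ) : 0 ≤ minSignal v :=
  Real.sInf_nonneg (by rintro _ ⟨j, _, rfl⟩; exact abs_nonneg _)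

lemma minSignal_le {p : ℕ} {v : Fin p → ℝ} {j : Fin p} (hj : j ∈ supp v) : minSignal v ≤ |v j| :=
  csInf_le (Set.toFinite _).bddBelow ⟨j, mem_supp.1 hj, rfl⟩

lemma minSignal_pos {p : ℕ} {v : Fin p → ℝ} (hv : (supp v).Nonempty) : 0 < minSignal v := by
  obtain ⟨j, hj⟩ := hv
  have hne : ((fun j => |v j|) '' {j | v j ≠ 0}).Nonempty := ⟨_, j, mem_supp.1 hj, rfl⟩
  obtain ⟨i, hi, h⟩ := hne.csInf_mem (Set.toFinite _)
  unfold minSignal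
  rw [← h]
  exact abs_pos.2 hi

/-! ### Oracle property along a sequence of sample sizes -/

section Sequence

variable {p : ℕ → ℕ} {X : (n : ℕ) → Matrix (Fin n) (Fin (p n)) ℝ} {βs : (n : ℕ) → Fin (p n) → ℝ}
  {Ω : ℕ → Type*} {ε : (n : ℕ) → Fin n → Ω n → ℝ}
  {pen : ℝ → ℝ → ℝ} {a b : ℝ} {τ lam : ℕ → ℝ} {βhat : (n : ℕ) → Ω n → ℝ → Fin (p n) → ℝ}
  {k : ℕ} {κ η H : ℝ} {σ : ℝ≥0}

lemma eventually_eq_oracle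
    (hX : ∀ᶠ n in atTop, SparseDesign (X n) (supp (βs n)) k κ η H)
    (hpen : IsNonconvexPenalty pen a b) (hτ : ∀ n, 0 < τ n) (hτ0 : Tendsto τ atTop (𝓝 0))
    (hpath : ∀ n ω l, 0 < l →
      IsCalibratedCCCP pen (X n) (response (X n) (βs n) (ε n) ω) (τ n) l (βhat n ω l))
    (hlam : ∀ n, 0 < lam n) (hd : lam =o[atTop] fun n => minSignal (βs n)) :
    ∀ᶠ n in atTop, ∀ ω, (∀ j, |((X n)ᵀ *ᵥ fun i => ε n i ω) j| ≤ n * (τ n * lam n / 2)) →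
      βhat n ω (lam n) = oracle (X n) (supp (βs n)) (response (X n) (βs n) (ε n) ω) ∧
      supp (oracle (X n) (supp (βs n)) (response (X n) (βs n) (ε n) ω)) = supp (βs n) := by
  have ha := hpen.one_lt_a
  have t1 : Tendsto (fun n => η * (3 / 2 * τ n)) atTop (𝓝 0) := by
    simpa using (hτ0.const_mul (3 / 2)).const_mul η
  have t2 : Tendsto (fun n => τ n / 2 * (1 + H * η)) atTop (𝓝 0) := by
    simpa using (hτ0.div_const 2).mul_const (1 + H * η)
  filter_upwards [hX, t1.eventually_le_const (show (0 : ℝ) < 1 / 4 by norm_num),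
    t1.eventually_le_const hpen.b_pos, t2.eventually_le_const (show (0 : ℝ) < 1 / 4 by norm_num),
    hd.bound (show 0 < 1 / (a + 1) by positivity)] with n hXn h1 h2 h3 h4 ω hω
  rw [Real.norm_of_nonneg (hlam n).le, Real.norm_of_nonneg (minSignal_nonneg _),
    one_div, inv_mul_eq_div, le_div_iff₀ (by linarith)] at h4
  exact hXn.eq_oracle_of_isCalibratedCCCP hpen (hlam n) (hτ n) rfl hω h1 h2 h3
    (fun j hj => by linarith [minSignal_le hj]) (hpath n ω _ (hlam n))

lemma compl_eq_oracle_subset {n : ℕ} {ω₀ : Set (Ω n)}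
    (h : ∀ ω, (∀ j, |((X n)ᵀ *ᵥ fun i => ε n i ω) j| ≤ n * (τ n * lam n / 2)) → ω ∈ ω₀) :
    ω₀ᶜ ⊆ {ω | ∃ j, n * (τ n * lam n / 2) < |((X n)ᵀ *ᵥ fun i => ε n i ω) j|} := by
  intro ω hω
  by_contra hcon
  exact hω (h ω fun j => not_lt.1 fun hj => hcon ⟨j, hj⟩)

variable [∀ n, MeasurableSpace (Ω n)] {μ : (n : ℕ) → Measure (Ω n)}
  [∀ n, IsProbabilityMeasure (μ n)]

lemma eventually_correlation_bound
    (hX : ∀ᶠ n in atTop, SparseDesign (X n) (supp (βs n)) k κ η H)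
    (hε : ∀ n, IsSubgaussianNoise (μ n) (ε n) σ) (hτ : ∀ n, 0 < τ n) (hlam : ∀ n, 0 < lam n) :
    ∀ᶠ n in atTop,
      (μ n).real {ω | ∃ j, n * (τ n * lam n / 2) < |((X n)ᵀ *ᵥ fun i => ε n i ω) j|} ≤
      2 * p n * Real.exp (-(n * τ n ^ 2 * lam n ^ 2) / (8 * (σ : ℝ) ^ 2)) := by
  filter_upwards [hX] with n hXn
  refine ((hε n).measureReal_exists_correlation_gt_le hXn.n_pos hXn.std
    (mul_pos (hτ n) (hlam n)).le).trans (le_of_eq ?_)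
  rw [mul_pow, mul_assoc (n : ℝ)]

lemma tendsto_correlation_bound (hσ : 0 < σ)
    (hX : ∀ᶠ n in atTop, SparseDesign (X n) (supp (βs n)) k κ η H)
    (hε : ∀ n, IsSubgaussianNoise (μ n) (ε n) σ) (hτ : ∀ n, 0 < τ n) (hlam : ∀ n, 0 < lam n)
    (hu : Tendsto (fun n : ℕ => (n : ℝ) * τ n ^ 2 * lam n ^ 2) atTop atTop)
    (hlog : (fun n => Real.log (p n)) =o[atTop] (fun n : ℕ => (n : ℝ) * τ n ^ 2 * lam n ^ 2)) :
    Tendsto (fun n => (μ n).real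
      {ω | ∃ j, n * (τ n * lam n / 2) < |((X n)ᵀ *ᵥ fun i => ε n i ω) j|}) atTop (𝓝 0) := by
  have hσ' : (0 : ℝ) < σ := hσ
  have hp : ∀ᶠ n in atTop, 0 < p n := hX.mono fun n hXn => by
    obtain ⟨j, _⟩ := hXn.nonempty
    exact j.pos
  have h0 := (tendsto_mul_exp_neg_zero hp hu hlog (s := 8 * (σ : ℝ) ^ 2) (by positivity)).const_mul 2
  rw [mul_zero] at h0
  refine squeeze_zero' (Eventually.of_forall fun n => measureReal_nonneg) ?_ h0
  exact (eventually_correlation_bound hX hε hτ hlam).mono fun n hn => hn.trans_eq (by ring)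

lemma tendsto_prob_eq_oracle (hσ : 0 < σ)
    (hX : ∀ᶠ n in atTop, SparseDesign (X n) (supp (βs n)) k κ η H)
    (hε : ∀ n, IsSubgaussianNoise (μ n) (ε n) σ)
    (hpen : IsNonconvexPenalty pen a b) (hτ : ∀ n, 0 < τ n) (hτ0 : Tendsto τ atTop (𝓝 0))
    (hpath : ∀ n ω l, 0 < l →
      IsCalibratedCCCP pen (X n) (response (X n) (βs n) (ε n) ω) (τ n) l (βhat n ω l))
    (hlam : ∀ n, 0 < lam n) (hd : lam =o[atTop] fun n => minSignal (βs n))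
    (hu : Tendsto (fun n : ℕ => (n : ℝ) * τ n ^ 2 * lam n ^ 2) atTop atTop)
    (hlog : (fun n => Real.log (p n)) =o[atTop] (fun n : ℕ => (n : ℝ) * τ n ^ 2 * lam n ^ 2)) :
    Tendsto (fun n => prob (μ n) {ω | βhat n ω (lam n) =
      oracle (X n) (supp (βs n)) (response (X n) (βs n) (ε n) ω)}) atTop (𝓝 1) :=
  tendsto_prob_of_compl_subset
    ((eventually_eq_oracle hX hpen hτ hτ0 hpath hlam hd).mono fun _ hn =>
      compl_eq_oracle_subset fun ω hω => (hn ω hω).1)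
    (tendsto_correlation_bound hσ hX hε hτ hlam hu hlog)

lemma eventually_prob_eq_oracle_ge
    (hX : ∀ᶠ n in atTop, SparseDesign (X n) (supp (βs n)) k κ η H)
    (hε : ∀ n, IsSubgaussianNoise (μ n) (ε n) σ)
    (hpen : IsNonconvexPenalty pen a b) (hτ : ∀ n, 0 < τ n) (hτ0 : Tendsto τ atTop (𝓝 0))
    (hpath : ∀ n ω l, 0 < l →
      IsCalibratedCCCP pen (X n) (response (X n) (βs n) (ε n) ω) (τ n) l (βhat n ω l))
    (hlam : ∀ n, 0 < lam n) (hd : lam =o[atTop] fun n => minSignal (βs n)) :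
    ∀ᶠ n in atTop,
      1 - 8 * (p n : ℝ) * Real.exp (-((n : ℝ) * τ n ^ 2 * lam n ^ 2) / (8 * (σ : ℝ) ^ 2)) ≤
        prob (μ n) {ω | βhat n ω (lam n) =
          oracle (X n) (supp (βs n)) (response (X n) (βs n) (ε n) ω)} := by
  filter_upwards [eventually_eq_oracle hX hpen hτ hτ0 hpath hlam hd,
    eventually_correlation_bound hX hε hτ hlam] with n h1 h2
  refine le_trans ?_ (one_sub_le_prob (compl_eq_oracle_subset fun ω hω => (h1 ω hω).1))
  have : 0 ≤ (p n : ℝ) * Real.exp (-((n : ℝ) * τ n ^ 2 * lam n ^ 2) / (8 * (σ : ℝ) ^ 2)) := by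
    positivity
  linarith

/-- Between two sequences of different order there is one of intermediate order, here their
geometric mean. -/
lemma exists_isLittleO_between {r d : ℕ → ℝ} (hr : ∀ᶠ n in atTop, 0 < r n)
    (hd : ∀ᶠ n in atTop, 0 < d n) (hrd : r =o[atTop] d) :
    ∃ m : ℕ → ℝ, (∀ n, 0 < m n) ∧ m =o[atTop] d ∧ r =o[atTop] m ∧
      ∀ᶠ n in atTop, m n ^ 2 = r n * d n := by
  classical
  refine ⟨fun n => if 0 < r n * d n then √(r n * d n) else 1, fun n => ?_, ?_, ?_, ?_⟩
  · dsimp only; split_ifs with h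
    · exact Real.sqrt_pos.2 h
    · exact one_pos
  · refine IsLittleO.of_bound fun c hc => ?_
    filter_upwards [hr, hd, hrd.bound (show 0 < c ^ 2 by positivity)] with n h1 h2 h3
    rw [if_pos (mul_pos h1 h2), Real.norm_of_nonneg (Real.sqrt_nonneg _),
      Real.norm_of_nonneg h2.le, Real.sqrt_le_left (by positivity)]
    rw [Real.norm_of_nonneg h1.le, Real.norm_of_nonneg h2.le] at h3
    nlinarith
  · refine IsLittleO.of_bound fun c hc => ?_
    filter_upwards [hr, hd, hrd.bound (show 0 < c ^ 2 by positivity)] with n h1 h2 h3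
    rw [if_pos (mul_pos h1 h2), Real.norm_of_nonneg (Real.sqrt_nonneg _),
      Real.norm_of_nonneg h1.le]
    rw [Real.norm_of_nonneg h1.le, Real.norm_of_nonneg h2.le] at h3
    rw [← div_le_iff₀' hc]
    apply Real.le_sqrt_of_sq_le
    rw [div_pow, div_le_iff₀ (by positivity)]
    nlinarith
  · filter_upwards [hr, hd] with n h1 h2
    rw [if_pos (mul_pos h1 h2), Real.sq_sqrt (mul_pos h1 h2).le]

lemma exists_tuning_sequence (hσ : 0 < σ)
    (hX : ∀ᶠ n in atTop, SparseDesign (X n) (supp (βs n)) k κ η H)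
    (hε : ∀ n, IsSubgaussianNoise (μ n) (ε n) σ)
    (hpen : IsNonconvexPenalty pen a b) (hτ : ∀ n, 0 < τ n) (hτ0 : Tendsto τ atTop (𝓝 0))
    (hpath : ∀ n ω l, 0 < l →
      IsCalibratedCCCP pen (X n) (response (X n) (βs n) (ε n) ω) (τ n) l (βhat n ω l))
    (hp : ∀ᶠ n in atTop, 2 ≤ p n)
    (hd : (fun n : ℕ => √(Real.log (p n) / n) / τ n) =o[atTop] (fun n => minSignal (βs n))) :
    ∃ lam' : ℕ → ℝ, (∀ n, 0 < lam' n) ∧ lam' =o[atTop] (fun n => minSignal (βs n)) ∧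
      (fun n : ℕ => √(Real.log (p n) / n) / τ n) =o[atTop] lam' ∧
      Tendsto (fun n => prob (μ n) {ω | βhat n ω (lam' n) =
        oracle (X n) (supp (βs n)) (response (X n) (βs n) (ε n) ω)}) atTop (𝓝 1) := by
  have hlog2 : (0 : ℝ) < Real.log 2 := Real.log_pos (by norm_num)
  have hlogp : ∀ᶠ n in atTop, Real.log 2 ≤ Real.log (p n) := hp.mono fun n hn =>
    Real.log_le_log (by norm_num) (by exact_mod_cast hn)
  have hr : ∀ᶠ n : ℕ in atTop, 0 < √(Real.log (p n) / n) / τ n := by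
    filter_upwards [hlogp, eventually_gt_atTop 0] with n h1 h2
    have : (0 : ℝ) < n := by exact_mod_cast h2
    exact div_pos (Real.sqrt_pos.2 (div_pos (by linarith) this)) (hτ n)
  obtain ⟨m, hm0, hmd, hrm, hsq⟩ := exists_isLittleO_between hr
    (hX.mono fun n h => minSignal_pos h.nonempty) hd
  have hlog : (fun n => Real.log (p n)) =o[atTop] (fun n : ℕ => (n : ℝ) * τ n ^ 2 * m n ^ 2) := by
    have h1 : (fun n : ℕ => (n : ℝ) * τ n ^ 2 * (√(Real.log (p n) / n) / τ n) ^ 2) =o[atTop]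
        (fun n : ℕ => (n : ℝ) * τ n ^ 2 * m n ^ 2) :=
      (isBigO_refl _ _).mul_isLittleO (hrm.pow two_pos)
    refine h1.congr' ?_ EventuallyEq.rfl
    filter_upwards [hlogp, eventually_gt_atTop 0] with n h1 h2
    have h3 : (0 : ℝ) < n := by exact_mod_cast h2
    have h4 := (hτ n).ne'
    rw [div_pow, Real.sq_sqrt (div_nonneg (by linarith) h3.le)]
    field_simp
  have hu : Tendsto (fun n : ℕ => (n : ℝ) * τ n ^ 2 * m n ^ 2) atTop atTop := by
    have h1 : (fun _ : ℕ => Real.log 2) =O[atTop] fun n => Real.log (p n) := by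
      refine IsBigO.of_bound 1 (hlogp.mono fun n hn => ?_)
      rw [one_mul, Real.norm_of_nonneg hlog2.le, Real.norm_of_nonneg (hlog2.le.trans hn)]
      exact hn
    have h2 := (isLittleO_const_left_of_ne hlog2.ne').1 (h1.trans_isLittleO hlog)
    refine h2.congr fun n => Real.norm_of_nonneg (by positivity)
  exact ⟨m, hm0, hmd, hrm, tendsto_prob_eq_oracle hσ hX hε hpen hτ hτ0 hpath hm0 hmd hu hlog⟩

end Sequence
/-! ### Projections of the noise onto low-dimensional subspaces -/

lemma integrable_exp_sq_div_four_gaussianReal :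
    Integrable (fun x : ℝ => Real.exp (x ^ 2 / 4)) (gaussianReal 0 1) ∧
      ∫ x, Real.exp (x ^ 2 / 4) ∂(gaussianReal 0 1) = √2 := by
  have hpdf : ∀ x : ℝ, gaussianPDFReal 0 1 x * Real.exp (x ^ 2 / 4) =
      (√(2 * Real.pi))⁻¹ * Real.exp (-(1 / 4) * x ^ 2) := by
    intro x
    rw [gaussianPDFReal, mul_assoc, ← Real.exp_add]
    simp only [sub_zero, NNReal.coe_one, mul_one]
    congr 2; ring
  constructor
  · rw [gaussianReal_of_var_ne_zero 0 one_ne_zero,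
      integrable_withDensity_iff_integrable_smul' (by fun_prop)
        (ae_of_all _ fun _ => gaussianPDF_lt_top)]
    simp only [toReal_gaussianPDF, smul_eq_mul, hpdf]
    exact (integrable_exp_neg_mul_sq (by norm_num)).const_mul _
  · rw [integral_gaussianReal_eq_integral_smul one_ne_zero]
    simp only [smul_eq_mul, hpdf]
    rw [integral_const_mul, integral_gaussian, inv_mul_eq_div, ← Real.sqrt_div (by positivity)]
    congr 1
    have := Real.pi_ne_zero
    field_simp; norm_num

section Quadratic

variable {ι : Type*} [Fintype ι]

/-- The law of a standard Gaussian vector. -/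
noncomputable def stdGaussianPi (ι : Type*) [Fintype ι] : Measure (ι → ℝ) :=
  Measure.pi fun _ => gaussianReal 0 1

instance : IsProbabilityMeasure (stdGaussianPi ι) := by unfold stdGaussianPi; infer_instance

lemma lintegral_exp_sum_mul_stdGaussianPi (c : ι → ℝ) :
    ∫⁻ g, ENNReal.ofReal (Real.exp (∑ i, c i * g i)) ∂(stdGaussianPi ι) =
      ENNReal.ofReal (Real.exp ((∑ i, c i ^ 2) / 2)) := by
  unfold stdGaussianPi
  simp_rw [Finset.sum_div, Real.exp_sum]
  rw [← ofReal_integral_eq_lintegral_ofReal (Integrable.fintype_prod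
      (f := fun i x => Real.exp (c i * x)) fun i => integrable_exp_mul_gaussianReal (c i))
      (ae_of_all _ fun _ => Finset.prod_nonneg fun _ _ => (Real.exp_pos _).le),
    integral_fintype_prod_eq_prod (f := fun i x => Real.exp (c i * x))]
  congr 1
  refine Finset.prod_congr rfl fun i _ => ?_
  have := congrFun (mgf_fun_id_gaussianReal (μ := 0) (v := 1)) (c i)
  simpa [mgf] using this

lemma lintegral_exp_sum_sq_stdGaussianPi :
    ∫⁻ g, ENNReal.ofReal (Real.exp (∑ i, g i ^ 2 / 4)) ∂(stdGaussianPi ι) =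
      ENNReal.ofReal (√2 ^ Fintype.card ι) := by
  unfold stdGaussianPi
  simp_rw [Real.exp_sum]
  rw [← ofReal_integral_eq_lintegral_ofReal (Integrable.fintype_prod
      (f := fun _ x => Real.exp (x ^ 2 / 4)) fun i => integrable_exp_sq_div_four_gaussianReal.1)
      (ae_of_all _ fun _ => Finset.prod_nonneg fun _ _ => (Real.exp_pos _).le),
    integral_fintype_prod_eq_prod (f := fun _ x => Real.exp (x ^ 2 / 4))]
  simp [integrable_exp_sq_div_four_gaussianReal.2]

/-- Exponential moments of the squared length of a sub-Gaussian vector. -/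
lemma lintegral_exp_sum_sq_le {Ω : Type*} [MeasurableSpace Ω] {μ : Measure Ω}
    [IsProbabilityMeasure μ] {z : ι → Ω → ℝ} (hz : ∀ i, AEMeasurable (z i) μ) {σ : ℝ} (hσ : 0 < σ)
    (h : ∀ a : ι → ℝ, ∫⁻ ω, ENNReal.ofReal (Real.exp (∑ i, a i * z i ω)) ∂μ ≤
      ENNReal.ofReal (Real.exp (σ ^ 2 * (∑ i, a i ^ 2) / 2))) :
    ∫⁻ ω, ENNReal.ofReal (Real.exp ((∑ i, z i ω ^ 2) / (4 * σ ^ 2))) ∂μ ≤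
      ENNReal.ofReal (√2 ^ Fintype.card ι) := by
  set s := (√2 * σ)⁻¹ with hs
  have hs2 : s ^ 2 = 1 / (2 * σ ^ 2) := by
    rw [hs, inv_pow, mul_pow, Real.sq_sqrt (by norm_num), one_div]
  have h1 : ∀ ω, ENNReal.ofReal (Real.exp ((∑ i, z i ω ^ 2) / (4 * σ ^ 2))) =
      ∫⁻ g, ENNReal.ofReal (Real.exp (∑ i, s * z i ω * g i)) ∂(stdGaussianPi ι) := by
    intro ω
    rw [lintegral_exp_sum_mul_stdGaussianPi]
    congr 2
    simp_rw [mul_pow]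
    rw [← Finset.mul_sum, hs2]
    field_simp; ring
  simp_rw [h1]
  rw [lintegral_lintegral_swap]
  · rw [← lintegral_exp_sum_sq_stdGaussianPi (ι := ι)]
    refine lintegral_mono fun g => ?_
    have h2 := h fun i => s * g i
    have e1 : ∀ ω, ∑ i, s * z i ω * g i = ∑ i, s * g i * z i ω := fun ω =>
      Finset.sum_congr rfl fun i _ => by ring
    have e2 : σ ^ 2 * (∑ i, (s * g i) ^ 2) / 2 = ∑ i, g i ^ 2 / 4 := by
      simp_rw [mul_pow]
      rw [← Finset.mul_sum, hs2, ← Finset.sum_div]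
      field_simp; ring
    simp_rw [e1]
    rwa [e2] at h2
  · refine (Real.measurable_exp.comp_aemeasurable ?_).ennreal_ofReal
    refine Finset.aemeasurable_fun_sum _ fun i _ => ?_
    exact ((hz i).comp_quasiMeasurePreserving
      Measure.quasiMeasurePreserving_fst |>.const_mul s).mul
        ((measurable_pi_apply i).comp measurable_snd).aemeasurable

end Quadratic

lemma mulVec_mem_colSpan {n p : ℕ} (X : Matrix (Fin n) (Fin p) ℝ) {S : Finset (Fin p)}
    {b : Fin p → ℝ} (hb : supp b ⊆ S) : WithLp.toLp 2 (X *ᵥ b) ∈ colSpan X S := by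
  have h : WithLp.toLp 2 (X *ᵥ b) = ∑ j ∈ S, b j • WithLp.toLp 2 (fun i => X i j) := by
    ext i
    simp only [Matrix.mulVec, dotProduct, WithLp.ofLp_sum, WithLp.ofLp_smul, Finset.sum_apply,
      Pi.smul_apply, smul_eq_mul]
    rw [← Finset.sum_subset (Finset.subset_univ S)]
    · exact Finset.sum_congr rfl fun j _ => mul_comm _ _
    · intro j _ hj
      rw [eq_zero_of_notMem_supp fun h => hj (hb h), mul_zero]
  rw [h]
  exact Submodule.sum_mem _ fun j hj => Submodule.smul_mem _ _ (Submodule.subset_span ⟨j, hj, rfl⟩)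

lemma finrank_colSpan_le {n p : ℕ} (X : Matrix (Fin n) (Fin p) ℝ) (S : Finset (Fin p)) :
    Module.finrank ℝ (colSpan X S) ≤ S.card := by
  classical
  unfold colSpan
  rw [← Finset.coe_image]
  exact (finrank_span_finset_le_card _).trans Finset.card_image_le

section Noise

variable {n : ℕ} {Ω : Type*} [MeasurableSpace Ω] {μ : Measure Ω} [IsProbabilityMeasure μ]
  {ε : Fin n → Ω → ℝ} {σ : ℝ≥0}

/-- The noise projected onto the span of the columns in `S`. -/
lemma IsSubgaussianNoise.measureReal_exists_span_gt_le (h : IsSubgaussianNoise μ ε σ)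
    (hσ : 0 < σ) {p : ℕ} (Z : Matrix (Fin n) (Fin p) ℝ) (S : Finset (Fin p)) {T : ℝ} :
    μ.real {ω | ∃ b, supp b ⊆ S ∧
      T * sqNorm (Z *ᵥ b) < ((Z *ᵥ b) ⬝ᵥ fun i => ε i ω) ^ 2} ≤
      √2 ^ S.card * Real.exp (-T / (4 * (σ : ℝ) ^ 2)) := by
  have hσ' : (0 : ℝ) < σ := hσ
  set W := colSpan Z S
  set u := stdOrthonormalBasis ℝ W
  set z : Fin (Module.finrank ℝ W) → Ω → ℝ := fun k ω =>
    ((u k : EuclideanSpace ℝ (Fin n)).ofLp) ⬝ᵥ fun i => ε i ω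
  have hcomb : ∀ (a : Fin (Module.finrank ℝ W) → ℝ) ω, ∑ k, a k * z k ω =
      ((∑ k, a k • u k : W) : EuclideanSpace ℝ (Fin n)).ofLp ⬝ᵥ fun i => ε i ω := by
    intro a ω
    simp [z, sum_dotProduct, smul_dotProduct]
  have hnorm : ∀ (a : Fin (Module.finrank ℝ W) → ℝ),
      sqNorm ((∑ k, a k • u k : W) : EuclideanSpace ℝ (Fin n)).ofLp = ∑ k, a k ^ 2 := by
    intro a
    rw [sqNorm_eq_norm_sq, WithLp.toLp_ofLp, ← Submodule.coe_norm]
    change ‖∑ k, (WithLp.toLp 2 a).ofLp k • u k‖ ^ 2 = _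
    rw [u.sum_repr_symm, LinearIsometryEquiv.norm_map, EuclideanSpace.real_norm_sq_eq]
  have hz : ∀ k, AEMeasurable (z k) μ := fun k =>
    (h.hasSubgaussianMGF_dotProduct _).aemeasurable
  have hmgf : ∀ a : Fin (Module.finrank ℝ W) → ℝ,
      ∫⁻ ω, ENNReal.ofReal (Real.exp (∑ k, a k * z k ω)) ∂μ ≤
      ENNReal.ofReal (Real.exp ((σ : ℝ) ^ 2 * (∑ k, a k ^ 2) / 2)) := by
    intro a
    have hs := h.hasSubgaussianMGF_dotProduct
      ((∑ k, a k • u k : W) : EuclideanSpace ℝ (Fin n)).ofLp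
    have h1 := hs.mgf_le 1
    have h2 := hs.integrable_exp_mul 1
    simp only [one_mul, mgf, ← hcomb] at h1 h2
    rw [← ofReal_integral_eq_lintegral_ofReal h2 (ae_of_all _ fun _ => (Real.exp_pos _).le)]
    refine ENNReal.ofReal_le_ofReal (h1.trans_eq ?_)
    rw [NNReal.coe_mul, NNReal.coe_pow, Real.coe_toNNReal _ (sqNorm_nonneg _), hnorm]
    congr 1; ring
  have hmom := lintegral_exp_sum_sq_le hz hσ' hmgf
  have hsub : {ω | ∃ b, supp b ⊆ S ∧
      T * sqNorm (Z *ᵥ b) < ((Z *ᵥ b) ⬝ᵥ fun i => ε i ω) ^ 2} ⊆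
      {ω | ENNReal.ofReal (Real.exp (T / (4 * (σ : ℝ) ^ 2))) ≤
        ENNReal.ofReal (Real.exp ((∑ k, z k ω ^ 2) / (4 * (σ : ℝ) ^ 2)))} := by
    rintro ω ⟨b, hb, hlt⟩
    refine ENNReal.ofReal_le_ofReal (Real.exp_le_exp.2 ?_)
    gcongr
    set w : W := ⟨_, mulVec_mem_colSpan Z hb⟩ with hw
    have hrep : ∑ k, u.repr w k • u k = w := u.sum_repr w
    have h1 := hcomb (u.repr w) ω
    have h2 := hnorm (u.repr w)
    rw [hrep] at h1 h2
    change ∑ k, u.repr w k * z k ω = (Z *ᵥ b) ⬝ᵥ fun i => ε i ω at h1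
    change sqNorm (Z *ᵥ b) = _ at h2
    have h3 := Finset.sum_mul_sq_le_sq_mul_sq Finset.univ (fun k => u.repr w k) (fun k => z k ω)
    rw [h1, ← h2] at h3
    have h4 : T * sqNorm (Z *ᵥ b) < (∑ k, z k ω ^ 2) * sqNorm (Z *ᵥ b) := by linarith
    exact (lt_of_mul_lt_mul_right h4 (sqNorm_nonneg _)).le
  have hmeas : AEMeasurable (fun ω => ENNReal.ofReal
      (Real.exp ((∑ k, z k ω ^ 2) / (4 * (σ : ℝ) ^ 2)))) μ := by
    refine (Real.measurable_exp.comp_aemeasurable ?_).ennreal_ofReal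
    exact (Finset.aemeasurable_fun_sum _ fun i _ => (hz i).pow_const 2).div_const _
  have hmark := (mul_meas_ge_le_lintegral₀ hmeas
    (ENNReal.ofReal (Real.exp (T / (4 * (σ : ℝ) ^ 2))))).trans hmom
  have hreal := ENNReal.toReal_mono ENNReal.ofReal_ne_top hmark
  rw [ENNReal.toReal_mul, ENNReal.toReal_ofReal (Real.exp_pos _).le,
    ENNReal.toReal_ofReal (by positivity), Fintype.card_fin] at hreal
  have h5 := measureReal_mono hsub (μ := μ)
  have h6 : √2 ^ Module.finrank ℝ W ≤ √2 ^ S.card :=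
    pow_le_pow_right₀ (Real.one_le_sqrt.2 (by norm_num)) (finrank_colSpan_le Z S)
  rw [neg_div, Real.exp_neg, ← div_eq_mul_inv, le_div_iff₀ (Real.exp_pos _), mul_comm]
  exact (mul_le_mul_of_nonneg_left h5 (Real.exp_pos _).le).trans (hreal.trans h6)

/-- Uniform control of the projected noise over all models. -/
lemma IsSubgaussianNoise.measureReal_exists_sparse_gt_le (h : IsSubgaussianNoise μ ε σ)
    (hσ : 0 < σ) {p : ℕ} (hp : 0 < p) (Z : Matrix (Fin n) (Fin p) ℝ) :
    μ.real {ω | ∃ b, 8 * (σ : ℝ) ^ 2 * Real.log p * (supp b).card * sqNorm (Z *ᵥ b) <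
      ((Z *ᵥ b) ⬝ᵥ fun i => ε i ω) ^ 2} ≤ Real.exp (√2 / p) - 1 := by
  classical
  have hσ' : (0 : ℝ) < σ := hσ
  have hp' : (0 : ℝ) < p := by exact_mod_cast hp
  set x := √2 * Real.exp (-(2 * Real.log p)) with hx
  have hx' : x = √2 / p ^ 2 := by
    rw [hx, Real.exp_neg, two_mul, Real.exp_add, Real.exp_log hp', ← sq, div_eq_mul_inv]
  have hx0 : 0 ≤ x := by positivity
  have hsub : {ω | ∃ b, 8 * (σ : ℝ) ^ 2 * Real.log p * (supp b).card * sqNorm (Z *ᵥ b) <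
      ((Z *ᵥ b) ⬝ᵥ fun i => ε i ω) ^ 2} ⊆
      ⋃ S ∈ (Finset.univ : Finset (Finset (Fin p))).erase ∅, {ω | ∃ b, supp b ⊆ S ∧
        (8 * (σ : ℝ) ^ 2 * Real.log p * S.card) * sqNorm (Z *ᵥ b) <
          ((Z *ᵥ b) ⬝ᵥ fun i => ε i ω) ^ 2} := by
    rintro ω ⟨b, hb⟩
    simp only [Set.mem_iUnion]
    refine ⟨supp b, ?_, b, subset_rfl, hb⟩
    refine Finset.mem_erase.2 ⟨fun h0 => ?_, Finset.mem_univ _⟩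
    have : b = 0 := by
      ext j; exact eq_zero_of_notMem_supp (by rw [h0]; simp)
    rw [this] at hb
    simp [sqNorm] at hb
  refine (measureReal_mono hsub (measure_ne_top _ _)).trans ((measureReal_biUnion_finset_le _ _).trans ?_)
  calc ∑ S ∈ (Finset.univ : Finset (Finset (Fin p))).erase ∅, μ.real {ω | ∃ b, supp b ⊆ S ∧
        (8 * (σ : ℝ) ^ 2 * Real.log p * S.card) * sqNorm (Z *ᵥ b) <
          ((Z *ᵥ b) ⬝ᵥ fun i => ε i ω) ^ 2}
      ≤ ∑ S ∈ (Finset.univ : Finset (Finset (Fin p))).erase ∅, x ^ S.card := by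
        refine Finset.sum_le_sum fun S _ => ?_
        refine (h.measureReal_exists_span_gt_le hσ Z S).trans (le_of_eq ?_)
        rw [hx, mul_pow, ← Real.exp_nat_mul]
        congr 2
        field_simp; ring
    _ = (x + 1) ^ p - 1 := by
        have := Fin.sum_pow_mul_eq_add_pow (n := p) x 1
        simp only [one_pow, mul_one] at this
        rw [← this, ← Finset.add_sum_erase _ _ (Finset.mem_univ (∅ : Finset (Fin p)))]
        simp
    _ ≤ Real.exp (√2 / p) - 1 := by
        have h1 : (x + 1) ^ p ≤ Real.exp x ^ p := pow_le_pow_left₀ (by positivity)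
          (Real.add_one_le_exp x) p
        rw [← Real.exp_nat_mul] at h1
        have h2 : (p : ℝ) * x = √2 / p := by rw [hx']; field_simp
        rw [h2] at h1
        linarith

/-! ### The law of large numbers for the squared noise -/

lemma pow_le_exp_add_exp_neg (x : ℝ) {m : ℕ} (hm : Even m) :
    x ^ m ≤ m.factorial * (Real.exp x + Real.exp (-x)) := by
  have h := Real.pow_div_factorial_le_exp |x| (abs_nonneg x) m
  rw [div_le_iff₀ (by positivity), hm.pow_abs] at h
  have h2 : Real.exp |x| ≤ Real.exp x + Real.exp (-x) := by
    rcases abs_cases x with ⟨h', _⟩ | ⟨h', _⟩ <;> rw [h'] <;>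
      linarith [Real.exp_pos x, Real.exp_pos (-x)]
  calc x ^ m ≤ Real.exp |x| * m.factorial := h
    _ ≤ _ := by rw [mul_comm]; gcongr

lemma integrable_even_pow {Ω : Type*} [MeasurableSpace Ω] {μ : Measure Ω} {Y : Ω → ℝ} {c : ℝ≥0} (hY : HasSubgaussianMGF Y c μ) {m : ℕ}
    (hm : Even m) : Integrable (fun ω => Y ω ^ m) μ ∧
      ∫ ω, Y ω ^ m ∂μ ≤ m.factorial * (2 * Real.exp (c / 2)) := by
  have h1 := hY.integrable_exp_mul 1
  have h2 := hY.integrable_exp_mul (-1)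
  have m1 := hY.mgf_le 1
  have m2 := hY.mgf_le (-1)
  simp only [one_mul, neg_mul, mgf, one_pow, mul_one, even_two, Even.neg_pow] at h1 h2 m1 m2
  have hdom : Integrable (fun ω => m.factorial * (Real.exp (Y ω) + Real.exp (-Y ω))) μ :=
    (h1.add h2).const_mul _
  have hint : Integrable (fun ω => Y ω ^ m) μ := by
    refine hdom.mono' (hY.aemeasurable.pow_const m).aestronglyMeasurable (ae_of_all _ fun ω => ?_)
    rw [Real.norm_of_nonneg (hm.pow_nonneg _)]
    exact pow_le_exp_add_exp_neg _ hm
  refine ⟨hint, (integral_mono hint hdom fun ω => pow_le_exp_add_exp_neg _ hm).trans ?_⟩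
  rw [integral_const_mul, integral_add h1 h2]
  gcongr
  linarith

/-- The empirical second moment of the noise is bounded and bounded away from zero. -/
lemma IsSubgaussianNoise.measureReal_sqNorm_notMem_le (h : IsSubgaussianNoise μ ε σ) (hn : 0 < n)
    {v : ℝ} (hv : 0 < v) (hvar : ∀ i, v ≤ variance (ε i) μ) :
    μ.real {ω | ¬ (n * (v / 2) ≤ sqNorm (fun i => ε i ω) ∧
      sqNorm (fun i => ε i ω) ≤ n * (4 * Real.exp ((σ : ℝ) ^ 2 / 2) + v / 2))} ≤
      192 * Real.exp ((σ : ℝ) ^ 2 / 2) / v ^ 2 * (n : ℝ)⁻¹ := by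
  have hn' : (0 : ℝ) < n := by exact_mod_cast hn
  set Y : Fin n → Ω → ℝ := fun i ω => ε i ω ^ 2
  have h4 : ∀ i, Integrable (fun ω => Y i ω ^ 2) μ ∧
      ∫ ω, Y i ω ^ 2 ∂μ ≤ 48 * Real.exp ((σ : ℝ) ^ 2 / 2) := by
    intro i
    have := integrable_even_pow (h.subgaussian i) (m := 4) (by decide)
    simp only [Y, ← pow_mul]
    refine ⟨this.1, this.2.trans_eq ?_⟩
    norm_num [Nat.factorial]; ring
  have h2 : ∀ i, Integrable (Y i) μ ∧ ∫ ω, Y i ω ∂μ ≤ 4 * Real.exp ((σ : ℝ) ^ 2 / 2) := by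
    intro i
    have := integrable_even_pow (h.subgaussian i) (m := 2) (by decide)
    refine ⟨this.1, this.2.trans_eq ?_⟩
    norm_num [Nat.factorial]; ring
  have h2' : ∀ i, v ≤ ∫ ω, Y i ω ∂μ := fun i => by
    have := hvar i
    rwa [variance_of_integral_eq_zero (h.subgaussian i).aemeasurable (h.mean_zero i)] at this
  have hmem : ∀ i, MemLp (Y i) 2 μ := fun i =>
    (memLp_two_iff_integrable_sq (h2 i).1.aestronglyMeasurable).2 (h4 i).1
  have hind : iIndepFun Y μ := h.indep.comp (fun _ x => x ^ 2) fun _ => measurable_id.pow_const 2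
  have hvarsum : variance (∑ i, Y i) μ ≤ n * (48 * Real.exp ((σ : ℝ) ^ 2 / 2)) := by
    rw [IndepFun.variance_sum (fun i _ => hmem i) fun i _ j _ hij => hind.indepFun hij]
    calc ∑ i, variance (Y i) μ ≤ ∑ _i : Fin n, 48 * Real.exp ((σ : ℝ) ^ 2 / 2) := by
          refine Finset.sum_le_sum fun i _ => ?_
          exact (variance_le_expectation_sq (h2 i).1.aestronglyMeasurable).trans (h4 i).2
      _ = _ := by simp
  have hexp : ∫ ω, (∑ i, Y i) ω ∂μ = ∑ i, ∫ ω, Y i ω ∂μ := by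
    simp only [Finset.sum_apply]
    exact integral_finsetSum _ fun i _ => (h2 i).1
  have hlo : n * v ≤ ∫ ω, (∑ i, Y i) ω ∂μ := by
    rw [hexp]
    calc n * v = ∑ _i : Fin n, v := by simp
      _ ≤ _ := Finset.sum_le_sum fun i _ => h2' i
  have hhi : ∫ ω, (∑ i, Y i) ω ∂μ ≤ n * (4 * Real.exp ((σ : ℝ) ^ 2 / 2)) := by
    rw [hexp]
    calc _ ≤ ∑ _i : Fin n, 4 * Real.exp ((σ : ℝ) ^ 2 / 2) :=
          Finset.sum_le_sum fun i _ => (h2 i).2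
      _ = _ := by simp
  have hcheb := meas_ge_le_variance_div_sq (memLp_finsetSum' Finset.univ fun i _ => hmem i)
    (show 0 < n * (v / 2) by positivity)
  have hcheb' := ENNReal.toReal_mono ENNReal.ofReal_ne_top hcheb
  rw [ENNReal.toReal_ofReal (div_nonneg (variance_nonneg _ _) (by positivity))] at hcheb'
  refine (measureReal_mono (fun ω hω => ?_)).trans (hcheb'.trans ?_)
  · by_contra hcon
    refine hω ?_
    have hlt : |(∑ i, Y i) ω - ∫ ω, (∑ i, Y i) ω ∂μ| < n * (v / 2) := not_le.1 hcon
    have heq : (∑ i, Y i) ω = sqNorm fun i => ε i ω := by simp [sqNorm, Y]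
    rw [heq] at hlt
    obtain ⟨h5, h6⟩ := abs_lt.1 hlt
    constructor <;> linarith
  · calc variance (∑ i, Y i) μ / (n * (v / 2)) ^ 2
        ≤ n * (48 * Real.exp ((σ : ℝ) ^ 2 / 2)) / (n * (v / 2)) ^ 2 := by gcongr
      _ = _ := by field_simp; ring

end Noise
/-! ### Residual sums of squares and the HBIC -/

lemma two_mul_le_of_sq_le_mul {x c s : ℝ} (hc : 0 ≤ c) (hs : 0 ≤ s) (h : x ^ 2 ≤ c * s) :
    2 * x ≤ c + s := by
  refine le_of_abs_le (abs_le_of_sq_le_sq ?_ (by linarith))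
  nlinarith [sq_nonneg (c - s)]

variable {n p : ℕ} {X : Matrix (Fin n) (Fin p) ℝ} {A : Finset (Fin p)}

lemma residualSq_le (X : Matrix (Fin n) (Fin p) ℝ) {B : Finset (Fin p)} (v : Fin n → ℝ)
    {b : Fin p → ℝ} (hb : supp b ⊆ B) : residualSq X B v ≤ sqNorm (v - X *ᵥ b) := by
  unfold residualSq
  rw [sqNorm_eq_norm_sq]
  gcongr
  rw [Submodule.starProjection_minimal]
  exact ciInf_le ⟨0, Set.forall_mem_range.mpr fun _ => norm_nonneg _⟩
    (⟨_, mulVec_mem_colSpan X hb⟩ : colSpan X B)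

/-- The columns of `X`, each with its projection onto the columns in `A` removed. -/
noncomputable def residualDesign (X : Matrix (Fin n) (Fin p) ℝ) (A : Finset (Fin p)) :
    Matrix (Fin n) (Fin p) ℝ :=
  Matrix.of fun i j => X i j - (X *ᵥ oracle X A fun i => X i j) i

/-- The coefficients of the projection of `X b` onto the columns in `A`. -/
noncomputable def projCoef (X : Matrix (Fin n) (Fin p) ℝ) (A : Finset (Fin p)) (b : Fin p → ℝ) :
    Fin p → ℝ :=
  ∑ j, b j • oracle X A fun i => X i j

lemma projCoef_apply_of_notMem {b : Fin p → ℝ} {k : Fin p} (hk : k ∉ A) :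
    projCoef X A b k = 0 := by
  simp [projCoef, oracle, hk]

lemma residualDesign_mulVec (X : Matrix (Fin n) (Fin p) ℝ) (A : Finset (Fin p)) (b : Fin p → ℝ) :
    residualDesign X A *ᵥ b = X *ᵥ (b - projCoef X A b) := by
  rw [Matrix.mulVec_sub, projCoef, Matrix.mulVec_sum]
  ext i
  simp only [residualDesign, Matrix.mulVec_smul, Pi.sub_apply, Finset.sum_apply, Pi.smul_apply,
    smul_eq_mul]
  change ∑ j, (X i j - _) * b j = ∑ j, X i j * b j - _
  rw [← Finset.sum_sub_distrib]
  exact Finset.sum_congr rfl fun j _ => by ring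

lemma residualDesign_mulVec_dotProduct (hinj : ∀ w, supp w ⊆ A → X *ᵥ w = 0 → w = 0)
    (b : Fin p → ℝ) {c : Fin p → ℝ} (hc : ∀ j ∉ A, c j = 0) :
    (residualDesign X A *ᵥ b) ⬝ᵥ (X *ᵥ c) = 0 := by
  have h : residualDesign X A *ᵥ b = ∑ j, b j •
      ((fun i => X i j) - X *ᵥ oracle X A fun i => X i j) := by
    ext i
    simp only [Finset.sum_apply, Pi.smul_apply, Pi.sub_apply, smul_eq_mul]
    have : ∑ j, residualDesign X A i j * b j = ∑ j, b j * residualDesign X A i j :=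
      Finset.sum_congr rfl fun j _ => mul_comm _ _
    exact this
  rw [h, sum_dotProduct]
  refine Finset.sum_eq_zero fun j _ => ?_
  rw [smul_dotProduct, ← dotProduct_transpose_mulVec]
  suffices c ⬝ᵥ (Xᵀ *ᵥ ((fun i => X i j) - X *ᵥ oracle X A fun i => X i j)) = 0 by
    rw [this, smul_zero]
  refine Finset.sum_eq_zero fun k _ => ?_
  by_cases hk : k ∈ A
  · rw [oracle_normal_equations hinj _ hk, mul_zero]
  · rw [hc k hk, zero_mul]

/-- Good behaviour of the noise `e` with respect to all sparse models: a constant `T` per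
coordinate bounds its correlation with the design and with the design orthogonal to `A`. -/
structure SparseNoise (X : Matrix (Fin n) (Fin p) ℝ) (A : Finset (Fin p)) (e : Fin n → ℝ) (T : ℝ) :
    Prop where
  injective : ∀ w, supp w ⊆ A → X *ᵥ w = 0 → w = 0
  nonneg : 0 ≤ T
  design : ∀ b, ((X *ᵥ b) ⬝ᵥ e) ^ 2 ≤ T * (supp b).card * sqNorm (X *ᵥ b)
  residual : ∀ b, ((residualDesign X A *ᵥ b) ⬝ᵥ e) ^ 2 ≤
    T * (supp b).card * sqNorm (residualDesign X A *ᵥ b)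

namespace SparseNoise

variable {e : Fin n → ℝ} {T : ℝ} {βs : Fin p → ℝ}

lemma residual_dotProduct (h : SparseNoise X A e T) (y : Fin n → ℝ) {c : Fin p → ℝ}
    (hc : ∀ j ∉ A, c j = 0) : (y - X *ᵥ oracle X A y) ⬝ᵥ (X *ᵥ c) = 0 := by
  rw [← dotProduct_transpose_mulVec]
  refine Finset.sum_eq_zero fun k _ => ?_
  by_cases hk : k ∈ A
  · rw [oracle_normal_equations h.injective _ hk, mul_zero]
  · rw [hc k hk, zero_mul]

lemma oracle_apply_of_notMem {y : Fin n → ℝ} {j : Fin p} (hj : j ∉ A) : oracle X A y j = 0 := by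
  simp [oracle, hj]

lemma oracle_rss_le (h : SparseNoise X A e T) (hA : supp βs = A) :
    sqNorm (X *ᵥ βs + e - X *ᵥ oracle X A (X *ᵥ βs + e)) ≤ sqNorm e := by
  set y := X *ᵥ βs + e with hy
  set o := oracle X A y
  have h1 : y - X *ᵥ o - X *ᵥ (βs - o) = e := by rw [Matrix.mulVec_sub, hy]; abel
  have h2 := sqNorm_sub (y - X *ᵥ o) (X *ᵥ (βs - o))
  rw [h1, h.residual_dotProduct y (fun j hj => by
    rw [Pi.sub_apply, show o j = 0 from oracle_apply_of_notMem hj,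
      eq_zero_of_notMem_supp (w := βs) (by rwa [hA]), sub_zero])] at h2
  linarith [sqNorm_nonneg (X *ᵥ (βs - o))]

lemma le_oracle_rss (h : SparseNoise X A e T) (hA : supp βs = A) :
    sqNorm e - T * A.card ≤ sqNorm (X *ᵥ βs + e - X *ᵥ oracle X A (X *ᵥ βs + e)) := by
  set y := X *ᵥ βs + e with hy
  set o := oracle X A y
  have h1 : y - X *ᵥ o = e - X *ᵥ (o - βs) := by rw [Matrix.mulVec_sub, hy]; abel
  rw [h1, sqNorm_sub, dotProduct_comm]
  have hcard : ((supp (o - βs)).card : ℝ) ≤ A.card := by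
    refine mod_cast Finset.card_le_card fun j hj => ?_
    by_contra hjA
    refine mem_supp.1 hj ?_
    rw [Pi.sub_apply, show o j = 0 from oracle_apply_of_notMem hjA,
      eq_zero_of_notMem_supp (w := βs) (by rwa [hA]), sub_zero]
  have h2 := two_mul_le_of_sq_le_mul (mul_nonneg h.nonneg (Nat.cast_nonneg A.card))
    (sqNorm_nonneg (X *ᵥ (o - βs))) ((h.design (o - βs)).trans (by
      have := h.nonneg
      have := sqNorm_nonneg (X *ᵥ (o - βs))
      gcongr))
  linarith

/-- Every model that adds coordinates to `A` gains at most `T` per added coordinate. -/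
lemma oracle_rss_sub_le (h : SparseNoise X A e T) (hA : supp βs = A) (β : Fin p → ℝ) :
    sqNorm (X *ᵥ βs + e - X *ᵥ oracle X A (X *ᵥ βs + e)) - T * (supp β \ A).card ≤
      sqNorm (X *ᵥ βs + e - X *ᵥ β) := by
  set y := X *ᵥ βs + e with hy
  set o := oracle X A y
  set d := β - o
  set b := restrictTo (supp β \ A) d with hb
  set c := d - b + projCoef X A b
  set Z := residualDesign X A
  have hc : ∀ j ∉ A, c j = 0 := by
    intro j hj
    have hoj : o j = 0 := oracle_apply_of_notMem hj
    simp only [c, Pi.add_apply, Pi.sub_apply, projCoef_apply_of_notMem hj, hb, restrictTo,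
      Finset.mem_sdiff, hj, not_false_eq_true, and_true, d, hoj, mem_supp]
    by_cases hβ : β j = 0 <;> simp [hβ]
  have hd : X *ᵥ d = Z *ᵥ b + X *ᵥ c := by
    rw [residualDesign_mulVec, ← Matrix.mulVec_add]
    congr 1; simp only [c]; abel
  have hr : y - X *ᵥ o = e - X *ᵥ (o - βs) := by rw [Matrix.mulVec_sub, hy]; abel
  have hob : ∀ j ∉ A, (o - βs) j = 0 := fun j hj => by
    rw [Pi.sub_apply, show o j = 0 from oracle_apply_of_notMem hj,
      eq_zero_of_notMem_supp (w := βs) (by rwa [hA]), sub_zero]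
  have h1 : (y - X *ᵥ o) ⬝ᵥ (X *ᵥ d) = (Z *ᵥ b) ⬝ᵥ e := by
    rw [hd, dotProduct_add, h.residual_dotProduct y hc, add_zero, hr, sub_dotProduct,
      dotProduct_comm (X *ᵥ (o - βs)), residualDesign_mulVec_dotProduct h.injective b hob, sub_zero,
      dotProduct_comm]
  have h2 : sqNorm (X *ᵥ d) = sqNorm (Z *ᵥ b) + sqNorm (X *ᵥ c) := by
    have h0 := residualDesign_mulVec_dotProduct h.injective b hc
    rw [hd, sqNorm_eq_dotProduct, add_dotProduct, dotProduct_add, dotProduct_add, h0,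
      dotProduct_comm (X *ᵥ c) (Z *ᵥ b), h0, sqNorm_eq_dotProduct, sqNorm_eq_dotProduct]
    ring
  have h3 : y - X *ᵥ β = y - X *ᵥ o - X *ᵥ d := by rw [Matrix.mulVec_sub]; abel
  rw [h3, sqNorm_sub (y - X *ᵥ o), h1, h2]
  have hcard : ((supp b).card : ℝ) ≤ (supp β \ A).card := by
    exact_mod_cast Finset.card_le_card (supp_restrictTo_subset _ _)
  have h4 := two_mul_le_of_sq_le_mul (mul_nonneg h.nonneg (Nat.cast_nonneg (supp β \ A).card))
    (sqNorm_nonneg (Z *ᵥ b)) ((h.residual b).trans (by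
      have := h.nonneg
      have := sqNorm_nonneg (Z *ᵥ b)
      gcongr))
  linarith [sqNorm_nonneg (X *ᵥ c)]

/-- Models that miss a relevant coordinate have a large residual sum of squares. -/
lemma underfit_rss_ge (h : SparseNoise X A e T) (hA : supp βs = A) {β : Fin p → ℝ} {D : ℝ}
    (hD : D ≤ residualSq X (supp β) (X *ᵥ βs)) :
    sqNorm e + D / 2 - 2 * T * ((supp β).card + A.card) ≤ sqNorm (X *ᵥ βs + e - X *ᵥ β) := by
  have h1 : X *ᵥ βs + e - X *ᵥ β = e - X *ᵥ (β - βs) := by rw [Matrix.mulVec_sub]; abel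
  rw [h1, sqNorm_sub, dotProduct_comm]
  have h2 : D ≤ sqNorm (X *ᵥ (β - βs)) := by
    refine hD.trans ((residualSq_le X (X *ᵥ βs) subset_rfl).trans (le_of_eq ?_))
    rw [← Matrix.mulVec_sub, ← neg_sub β βs, Matrix.mulVec_neg]
    simp [sqNorm]
  have hcard : ((supp (β - βs)).card : ℝ) ≤ (supp β).card + A.card := by
    have : supp (β - βs) ⊆ supp β ∪ A := by
      intro j hj
      by_contra hcon
      simp only [Finset.mem_union, not_or, ← hA] at hcon
      refine mem_supp.1 hj ?_
      rw [Pi.sub_apply, eq_zero_of_notMem_supp hcon.1, eq_zero_of_notMem_supp hcon.2, sub_zero]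
    exact_mod_cast (Finset.card_le_card this).trans (Finset.card_union_le _ _)
  have hs := sqNorm_nonneg (X *ᵥ (β - βs))
  have h4 := two_mul_le_of_sq_le_mul (x := (X *ᵥ (β - βs)) ⬝ᵥ e)
    (c := 2 * T * ((supp β).card + A.card)) (s := sqNorm (X *ᵥ (β - βs)) / 2)
    (mul_nonneg (mul_nonneg two_pos.le h.nonneg) (by positivity)) (by positivity)
    ((h.design (β - βs)).trans (by
      have := h.nonneg
      calc T * (supp (β - βs)).card * sqNorm (X *ᵥ (β - βs))
          ≤ T * ((supp β).card + A.card) * sqNorm (X *ᵥ (β - βs)) := by gcongr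
        _ = _ := by ring))
  linarith

end SparseNoise

lemma log_sub_log_ge {x y : ℝ} (hx : 0 < x) (hy : 0 < y) : (y - x) / y ≤ Real.log y - Real.log x := by
  rw [← Real.log_div hy.ne' hx.ne']
  refine le_trans (le_of_eq ?_) (Real.one_sub_inv_le_log_of_pos (div_pos hy hx))
  field_simp

/-- Deterministic comparison of the HBIC of an arbitrary estimate with that of the oracle. -/
lemma hbic_oracle_le {e : Fin n → ℝ} {T C K v V κ : ℝ} {βs : Fin p → ℝ} (hn : 0 < n)
    (h : SparseNoise X A e T) (hA : supp βs = A)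
    (hsupp : supp (oracle X A (X *ᵥ βs + e)) = A) (hv : 0 < v) (hκ : 0 < κ)
    (hlow : n * v ≤ sqNorm e) (hup : sqNorm e ≤ n * V)
    (hq : (A.card : ℝ) ≤ K) (hTK : T * K ≤ n * v / 4) (hTK' : 4 * (T * K) ≤ n * κ / 4)
    (hC : 0 ≤ C) (hlog : 0 ≤ Real.log p) (hCT : 4 * T / v < C * Real.log p)
    (hqC : A.card * C * Real.log p < n * (κ / 4 / (V + κ / 4)))
    (hident : ∀ B : Finset (Fin p), ¬ A ⊆ B → (B.card : ℝ) ≤ K →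
      κ ≤ (n : ℝ)⁻¹ * residualSq X B (X *ᵥ βs))
    {β : Fin p → ℝ} (hβ : ((supp β).card : ℝ) ≤ K) :
    hbic X (X *ᵥ βs + e) C (oracle X A (X *ᵥ βs + e)) ≤ hbic X (X *ᵥ βs + e) C β ∧
    (supp β ≠ A →
      hbic X (X *ᵥ βs + e) C (oracle X A (X *ᵥ βs + e)) < hbic X (X *ᵥ βs + e) C β) := by
  have hn' : (0 : ℝ) < n := by exact_mod_cast hn
  have hT := h.nonneg
  have hup' := h.oracle_rss_le hA
  have hlow' := h.le_oracle_rss hA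
  have hover := h.oracle_rss_sub_le hA β
  unfold hbic
  rw [hsupp]
  set R := sqNorm (X *ᵥ βs + e - X *ᵥ oracle X A (X *ᵥ βs + e))
  set S := sqNorm (X *ᵥ βs + e - X *ᵥ β)
  have hTq : T * A.card ≤ n * v / 4 := (mul_le_mul_of_nonneg_left hq hT).trans hTK
  have hnv : 0 < n * v := by positivity
  have hR : n * v * (3 / 4) ≤ R := by linarith
  have hR0 : 0 < R := by linarith
  have hpen : 0 ≤ C * Real.log p / n := div_nonneg (mul_nonneg hC hlog) hn'.le
  by_cases hsub : A ⊆ supp β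
  · have hcard : ((supp β \ A).card : ℝ) + A.card = (supp β).card := by
      exact_mod_cast Finset.card_sdiff_add_card_eq_card hsub
    have hTs : T * (supp β \ A).card ≤ n * v / 4 := by
      refine le_trans (mul_le_mul_of_nonneg_left ?_ hT) hTK
      have : (0 : ℝ) ≤ A.card := Nat.cast_nonneg _
      linarith
    have hS : n * v / 2 ≤ S := by linarith
    have hS0 : 0 < S := by linarith
    have hl := log_sub_log_ge (x := R / n) (y := S / n) (by positivity) (by positivity)
    have e1 : (S / n - R / n) / (S / n) = (S - R) / S := by field_simp
    rw [e1] at hl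
    have hl2 : -((supp β \ A).card * (2 * T / (n * v))) ≤ (S - R) / S := by
      rw [le_div_iff₀ hS0]
      have h1 : T * (supp β \ A).card ≤ (supp β \ A).card * (2 * T / (n * v)) * S := by
        calc T * (supp β \ A).card = (supp β \ A).card * (2 * T / (n * v)) * (n * v / 2) := by
              field_simp
          _ ≤ _ := by gcongr
      linarith
    have hgap : 2 * T / (n * v) < C * Real.log p / n := by
      rw [mul_comm (n : ℝ) v, ← div_div]
      refine div_lt_div_of_pos_right (lt_of_le_of_lt ?_ hCT) hn'
      gcongr
      norm_num
    rw [← hcard]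
    constructor
    · have := mul_le_mul_of_nonneg_left hgap.le (Nat.cast_nonneg (α := ℝ) (supp β \ A).card)
      linarith
    · intro hne
      have hpos : (0 : ℝ) < (supp β \ A).card := by
        rw [Nat.cast_pos, Finset.card_pos, Finset.sdiff_nonempty]
        exact fun h' => hne (Finset.Subset.antisymm h' hsub)
      have := mul_lt_mul_of_pos_left hgap hpos
      linarith
  · suffices hlt : Real.log (R / n) + A.card * (C * Real.log p / n) <
        Real.log (S / n) + (supp β).card * (C * Real.log p / n) from ⟨hlt.le, fun _ => hlt⟩
    have hid := hident _ hsub hβ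
    rw [inv_mul_eq_div, le_div_iff₀ hn'] at hid
    have hS := h.underfit_rss_ge hA hid
    have hTT : 2 * T * ((supp β).card + A.card) ≤ n * κ / 4 := by
      refine le_trans ?_ hTK'
      have : T * ((supp β).card + A.card) ≤ T * (K + K) := by gcongr
      linarith
    have hSR : R + n * κ / 4 ≤ S := by linarith
    have hnκ : 0 < n * κ := by positivity
    have hS0 : 0 < S := by linarith
    have hl := log_sub_log_ge (x := R / n) (y := S / n) (by positivity) (by positivity)
    have e1 : (S / n - R / n) / (S / n) = (S - R) / S := by field_simp
    rw [e1] at hl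
    have hVκ : 0 < V + κ / 4 := by
      have : 0 < n * V := by linarith
      have := (mul_pos_iff_of_pos_left hn').1 this
      positivity
    have hl2 : κ / 4 / (V + κ / 4) ≤ (S - R) / S := by
      rw [div_le_div_iff₀ hVκ hS0]
      have hRV : R ≤ n * V := by linarith
      have h1 : κ / 4 * R ≤ κ / 4 * (n * V) := by gcongr
      have h2 : n * κ / 4 * V ≤ (S - R) * V := by
        have : 0 < n * V := by linarith
        have := (mul_pos_iff_of_pos_left hn').1 this
        gcongr; linarith
      nlinarith
    have hl3 : A.card * (C * Real.log p / n) < κ / 4 / (V + κ / 4) := by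
      rw [← mul_div_assoc, div_lt_iff₀ hn']
      linarith
    have hl4 := mul_nonneg (Nat.cast_nonneg (α := ℝ) (supp β).card) hpen
    linarith

/-- A minimizer of the HBIC over the path exists and identifies `A`, once the oracle lies on the
path. -/
lemma supp_eq_of_hbic {y : Fin n → ℝ} {C K l₀ : ℝ} {path : ℝ → Fin p → ℝ} {lhat : ℝ}
    (hl₀ : 0 < l₀) (hor : path l₀ = oracle X A y) (hsupp : supp (oracle X A y) = A)
    (hK : (A.card : ℝ) ≤ K)
    (hcomp : ∀ β : Fin p → ℝ, ((supp β).card : ℝ) ≤ K →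
      hbic X y C (oracle X A y) ≤ hbic X y C β ∧
      (supp β ≠ A → hbic X y C (oracle X A y) < hbic X y C β))
    (hlhat : (∃ l, IsHBICMin X y C K path l) → IsHBICMin X y C K path lhat) :
    supp (path lhat) = A := by
  have hex : IsHBICMin X y C K path l₀ := by
    refine ⟨⟨hl₀, by rw [hor, hsupp]; exact hK⟩, fun l' _ hl' => ?_⟩
    rw [hor]; exact (hcomp _ hl').1
  obtain ⟨⟨_, hcard⟩, hmin⟩ := hlhat ⟨l₀, hex⟩
  by_contra hne
  have h1 := (hcomp _ hcard).2 hne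
  have h2 := hmin l₀ hl₀ hex.1.2
  rw [hor] at h2
  linarith

/-! ### Consistency of the HBIC -/

section Sequence

variable {p : ℕ → ℕ} {X : (n : ℕ) → Matrix (Fin n) (Fin (p n)) ℝ} {βs : (n : ℕ) → Fin (p n) → ℝ}
  {Ω : ℕ → Type*} {ε : (n : ℕ) → Fin n → Ω n → ℝ}
  {pen : ℝ → ℝ → ℝ} {a b : ℝ} {τ lam : ℕ → ℝ} {βhat : (n : ℕ) → Ω n → ℝ → Fin (p n) → ℝ}
  {k : ℕ} {κ₀ η H : ℝ} {σ : ℝ≥0}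
  [∀ n, MeasurableSpace (Ω n)] {μ : (n : ℕ) → Measure (Ω n)} [∀ n, IsProbabilityMeasure (μ n)]

lemma isLittleO_of_sq_mul_log {K : ℕ → ℝ} {L : ℕ → ℝ} (hK : ∀ᶠ n in atTop, 1 ≤ K n)
    (hL : ∀ᶠ n in atTop, 0 ≤ L n)
    (h : (fun n : ℕ => K n ^ 2 * L n * Real.log n) =o[atTop] (fun n : ℕ => (n : ℝ))) :
    (fun n : ℕ => K n * L n) =o[atTop] (fun n : ℕ => (n : ℝ)) := by
  refine IsBigO.trans_isLittleO (IsBigO.of_bound 1 ?_) h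
  have hlog : ∀ᶠ n : ℕ in atTop, 1 ≤ Real.log n :=
    (Real.tendsto_log_atTop.comp tendsto_natCast_atTop_atTop).eventually_ge_atTop 1
  filter_upwards [hK, hL, hlog] with n h1 h2 h3
  rw [one_mul, Real.norm_of_nonneg (by positivity), Real.norm_of_nonneg (by positivity)]
  calc K n * L n = K n * L n * 1 * 1 := by ring
    _ ≤ K n * L n * K n * Real.log n := by gcongr
    _ = _ := by ring

lemma tendsto_prob_supp_eq (hσ : 0 < σ)
    (hX : ∀ᶠ n in atTop, SparseDesign (X n) (supp (βs n)) k κ₀ η H)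
    (hε : ∀ n, IsSubgaussianNoise (μ n) (ε n) σ)
    (hpen : IsNonconvexPenalty pen a b) (hτ : ∀ n, 0 < τ n) (hτ0 : Tendsto τ atTop (𝓝 0))
    (hpath : ∀ n ω l, 0 < l →
      IsCalibratedCCCP pen (X n) (response (X n) (βs n) (ε n) ω) (τ n) l (βhat n ω l))
    (hlam : ∀ n, 0 < lam n) (hd : lam =o[atTop] fun n => minSignal (βs n))
    {C K : ℕ → ℝ} {κ v : ℝ} {lhat : (n : ℕ) → Ω n → ℝ}
    (hp : Tendsto p atTop atTop)
    (hlog : (fun n => Real.log (p n)) =o[atTop] (fun n : ℕ => (n : ℝ) * τ n ^ 2 * lam n ^ 2))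
    (hv : 0 < v) (hvar : ∀ᶠ n in atTop, ∀ i, v ≤ variance (ε n i) (μ n)) (hκ : 0 < κ)
    (hident : ∀ᶠ n in atTop, ∀ A : Finset (Fin (p n)), ¬ supp (βs n) ⊆ A → (A.card : ℝ) ≤ K n →
      κ ≤ (n : ℝ)⁻¹ * residualSq (X n) A (X n *ᵥ βs n))
    (hK : ∀ᶠ n in atTop, ((supp (βs n)).card : ℝ) < K n)
    (hC : Tendsto C atTop atTop)
    (hqC : (fun n => ((supp (βs n)).card : ℝ) * C n * Real.log (p n))
      =o[atTop] (fun n : ℕ => (n : ℝ)))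
    (hK2 : (fun n : ℕ => K n ^ 2 * Real.log (p n) * Real.log n) =o[atTop] (fun n : ℕ => (n : ℝ)))
    (hlhat : ∀ n ω,
      (∃ l, IsHBICMin (X n) (response (X n) (βs n) (ε n) ω) (C n) (K n) (βhat n ω) l) →
      IsHBICMin (X n) (response (X n) (βs n) (ε n) ω) (C n) (K n) (βhat n ω) (lhat n ω)) :
    Tendsto (fun n => prob (μ n) {ω | supp (βhat n ω (lhat n ω)) = supp (βs n)})
      atTop (𝓝 1) := by
  have hσ' : (0 : ℝ) < σ := hσ
  have hp' : Tendsto (fun n => (p n : ℝ)) atTop atTop := tendsto_natCast_atTop_atTop.comp hp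
  have hlogp : Tendsto (fun n => Real.log (p n)) atTop atTop := Real.tendsto_log_atTop.comp hp'
  have hu : Tendsto (fun n : ℕ => (n : ℝ) * τ n ^ 2 * lam n ^ 2) atTop atTop := by
    refine tendsto_atTop_mono' _ ?_ hlogp
    filter_upwards [hlog.bound one_pos] with n hn
    rw [one_mul, Real.norm_of_nonneg (show 0 ≤ (n : ℝ) * τ n ^ 2 * lam n ^ 2 by positivity)] at hn
    exact (Real.le_norm_self _).trans hn
  set V := 4 * Real.exp ((σ : ℝ) ^ 2 / 2) + v / 2
  set T : ℕ → ℝ := fun n => 8 * (σ : ℝ) ^ 2 * Real.log (p n)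
  set B₁ : (n : ℕ) → Set (Ω n) := fun n =>
    {ω | ∃ j, n * (τ n * lam n / 2) < |((X n)ᵀ *ᵥ fun i => ε n i ω) j|}
  set B₂ : (n : ℕ) → Set (Ω n) := fun n =>
    {ω | ∃ b, T n * (supp b).card * sqNorm (X n *ᵥ b) < ((X n *ᵥ b) ⬝ᵥ fun i => ε n i ω) ^ 2}
  set B₃ : (n : ℕ) → Set (Ω n) := fun n =>
    {ω | ∃ b, T n * (supp b).card * sqNorm (residualDesign (X n) (supp (βs n)) *ᵥ b) <
      ((residualDesign (X n) (supp (βs n)) *ᵥ b) ⬝ᵥ fun i => ε n i ω) ^ 2}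
  set B₄ : (n : ℕ) → Set (Ω n) := fun n =>
    {ω | ¬ (n * (v / 2) ≤ sqNorm (fun i => ε n i ω) ∧ sqNorm (fun i => ε n i ω) ≤ n * V)}
  have t₁ : Tendsto (fun n => (μ n).real (B₁ n)) atTop (𝓝 0) :=
    tendsto_correlation_bound hσ hX hε hτ hlam hu hlog
  have hexp : Tendsto (fun n => Real.exp (√2 / p n) - 1) atTop (𝓝 0) := by
    have h1 : Tendsto (fun n => √2 / (p n : ℝ)) atTop (𝓝 0) := hp'.const_div_atTop _
    have h2 := (Real.continuous_exp.tendsto 0).comp h1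
    simpa using h2.sub_const 1
  have hpp : ∀ᶠ n in atTop, 0 < p n := hp.eventually_gt_atTop 0
  have t₂ : Tendsto (fun n => (μ n).real (B₂ n)) atTop (𝓝 0) :=
    squeeze_zero' (Eventually.of_forall fun n => measureReal_nonneg)
      (hpp.mono fun n hn => (hε n).measureReal_exists_sparse_gt_le hσ hn _) hexp
  have t₃ : Tendsto (fun n => (μ n).real (B₃ n)) atTop (𝓝 0) :=
    squeeze_zero' (Eventually.of_forall fun n => measureReal_nonneg)
      (hpp.mono fun n hn => (hε n).measureReal_exists_sparse_gt_le hσ hn _) hexp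
  have t₄ : Tendsto (fun n => (μ n).real (B₄ n)) atTop (𝓝 0) := by
    have h0 : Tendsto (fun n : ℕ => 192 * Real.exp ((σ : ℝ) ^ 2 / 2) / v ^ 2 * (n : ℝ)⁻¹)
        atTop (𝓝 0) := by
      simpa using (tendsto_inv_atTop_nhds_zero_nat (𝕜 := ℝ)).const_mul
        (192 * Real.exp ((σ : ℝ) ^ 2 / 2) / v ^ 2)
    refine squeeze_zero' (Eventually.of_forall fun n => measureReal_nonneg) ?_ h0
    filter_upwards [hvar, eventually_gt_atTop 0] with n h1 h2
    exact (hε n).measureReal_sqNorm_notMem_le h2 hv h1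
  have t : Tendsto (fun n => (μ n).real (B₁ n ∪ B₂ n ∪ B₃ n ∪ B₄ n)) atTop (𝓝 0) := by
    have h0 := ((t₁.add t₂).add t₃).add t₄
    simp only [add_zero] at h0
    refine squeeze_zero (fun n => measureReal_nonneg) (fun n => ?_) h0
    have e1 := measureReal_union_le (μ := μ n) (B₁ n ∪ B₂ n ∪ B₃ n) (B₄ n)
    have e2 := measureReal_union_le (μ := μ n) (B₁ n ∪ B₂ n) (B₃ n)
    have e3 := measureReal_union_le (μ := μ n) (B₁ n) (B₂ n)
    linarith
  refine tendsto_prob_of_compl_subset ?_ t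
  have hK1 : ∀ᶠ n in atTop, 1 ≤ K n := by
    filter_upwards [hK, hX] with n h1 h2
    have : (1 : ℝ) ≤ (supp (βs n)).card := by exact_mod_cast h2.nonempty.card_pos
    linarith
  have hKlog := isLittleO_of_sq_mul_log hK1 (hlogp.eventually_ge_atTop 0) hK2
  have hVκ : 0 < κ / 4 / (V + κ / 4) := by positivity
  filter_upwards [eventually_eq_oracle hX hpen hτ hτ0 hpath hlam hd, hX, hK, hident, hK1,
    hlogp.eventually_gt_atTop 0, hC.eventually_gt_atTop (64 * (σ : ℝ) ^ 2 / v),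
    hKlog.bound (show 0 < v / (64 * (σ : ℝ) ^ 2) by positivity),
    hKlog.bound (show 0 < κ / (128 * (σ : ℝ) ^ 2) by positivity),
    hqC.bound (show 0 < κ / 4 / (V + κ / 4) / 2 by positivity)]
    with n horacle hXn hKn hidn hK1n hlogn hCn hb1 hb2 hb3 ω hω
  by_contra hgood
  refine hω ?_
  simp only [B₁, B₂, B₃, B₄, Set.mem_union, Set.mem_ofPred_eq, not_or, not_exists, not_lt,
    not_not] at hgood
  obtain ⟨⟨⟨g₁, g₂⟩, g₃⟩, g₄⟩ := hgood
  obtain ⟨hor, hsupp⟩ := horacle ω g₁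
  have hn : (0 : ℝ) < n := by exact_mod_cast hXn.n_pos
  have hC0 : 0 < C n := lt_of_le_of_lt (by positivity) hCn
  rw [Real.norm_of_nonneg (by positivity), Real.norm_of_nonneg hn.le] at hb1 hb2 hb3
  have hnoise : SparseNoise (X n) (supp (βs n)) (fun i => ε n i ω) (T n) :=
    ⟨fun w => hXn.eq_zero_of_mulVec_eq_zero, by positivity, g₂, g₃⟩
  refine supp_eq_of_hbic (hlam n) hor hsupp hKn.le (fun β hβ => ?_) (hlhat n ω)
  refine hbic_oracle_le hXn.n_pos hnoise rfl hsupp (half_pos hv) hκ g₄.1 g₄.2 hKn.le ?_ ?_ hC0.le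
    hlogn.le ?_ ?_ hidn hβ
  · calc T n * K n = 8 * (σ : ℝ) ^ 2 * (K n * Real.log (p n)) := by simp only [T]; ring
      _ ≤ 8 * (σ : ℝ) ^ 2 * (v / (64 * (σ : ℝ) ^ 2) * n) := by gcongr
      _ = _ := by field_simp; ring
  · calc 4 * (T n * K n) = 32 * (σ : ℝ) ^ 2 * (K n * Real.log (p n)) := by simp only [T]; ring
      _ ≤ 32 * (σ : ℝ) ^ 2 * (κ / (128 * (σ : ℝ) ^ 2) * n) := by gcongr
      _ = _ := by field_simp; ring
  · calc 4 * T n / (v / 2) = 64 * (σ : ℝ) ^ 2 / v * Real.log (p n) := by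
          simp only [T]; field_simp; ring
      _ < _ := by gcongr
  · refine lt_of_le_of_lt hb3 ?_
    have := mul_pos hVκ hn
    linarith

end Sequence
end CalibratedCCCP

open CalibratedCCCP in
theorem theorem3
    -- dimensions, nonstochastic design and true parameter for each sample size n
    (p : ℕ → ℕ) (X : (n : ℕ) → Matrix (Fin n) (Fin (p n)) ℝ) (βs : (n : ℕ) → Fin (p n) → ℝ)
    -- random errors
    {Ω : ℕ → Type*} [∀ n, MeasurableSpace (Ω n)] (μ : (n : ℕ) → Measure (Ω n))
    [∀ n, IsProbabilityMeasure (μ n)] (ε : (n : ℕ) → Fin n → Ω n → ℝ)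
    -- penalty, tuning parameters, solution path
    (pen : ℝ → ℝ → ℝ) (a b : ℝ) (τ lam : ℕ → ℝ)
    (βhat : (n : ℕ) → Ω n → ℝ → Fin (p n) → ℝ)
    -- constants
    (C₁ α κmin ηmax ηmin : ℝ) (σ : ℝ≥0)
    -- the true model is nonempty and the columns are standardized
    (hA₀ : ∀ᶠ n in atTop, (supp (βs n)).Nonempty)
    (hstd : ∀ᶠ n in atTop, ∀ j, (∑ i, X n i j ^ 2) / (n : ℝ) = 1)
    -- (A1)
    (hC₁ : 0 < C₁) (hA1 : ∀ᶠ n in atTop, C₁ ≤ lamMin (gram (X n) (supp (βs n))))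
    -- (A2)
    (hσ : 0 < σ) (hA2 : ∀ n, IsSubgaussianNoise (μ n) (ε n) σ)
    -- (A3)
    (hA3 : IsNonconvexPenalty pen a b)
    -- (A4'); 1 ≤ α says that the maximum defining xiMax is over a nonempty family
    (hα : 1 ≤ α) (hκmin : 0 < κmin)
    (hA4min : ∀ᶠ n in atTop,
      κmin ≤ xiMin (X n) (supp (βs n)) ((α + 1) * (supp (βs n)).card))
    (hA4max : ∀ᶠ n in atTop,
      xiMax (X n) (supp (βs n)) (α * (supp (βs n)).card) / α ≤
        1 / 576 * κmin *
          (1 - 3 * √(xiMax (X n) (supp (βs n)) (α * (supp (βs n)).card) / (α * κmin))) ^ 2)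
    -- (A5)
    (hlam : ∀ n, 0 < lam n) (hτ : ∀ n, 0 < τ n)
    (hA5lam : lam =o[atTop] fun n => minSignal (βs n)) (hA5τ : Tendsto τ atTop (𝓝 0))
    -- (A6)
    (hA6max : ∀ᶠ n in atTop,
      zetaMax (X n) (supp (βs n)) ((α + 1) * (supp (βs n)).card) ≤ ηmax)
    (hA6min : ∀ᶠ n in atTop,
      zetaMin (X n) (supp (βs n)) ((α + 1) * (supp (βs n)).card) ≤ ηmin)
    -- the calibrated CCCP solution path
    (hpath : ∀ n ω l, 0 < l →
      IsCalibratedCCCP pen (X n) (response (X n) (βs n) (ε n) ω) (τ n) l (βhat n ω l)) :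
    -- (1)
    (∀ᶠ n in atTop,
      1 - 8 * (p n : ℝ) * Real.exp (-((n : ℝ) * τ n ^ 2 * lam n ^ 2) / (8 * (σ : ℝ) ^ 2)) ≤
        prob (μ n) {ω | βhat n ω (lam n) =
          oracle (X n) (supp (βs n)) (response (X n) (βs n) (ε n) ω)}) ∧
    -- (2)
    (Tendsto (fun n : ℕ => (n : ℝ) * τ n ^ 2 * lam n ^ 2) atTop atTop →
      (fun n => Real.log (p n)) =o[atTop] (fun n : ℕ => (n : ℝ) * τ n ^ 2 * lam n ^ 2) →
      Tendsto (fun n => prob (μ n) {ω | βhat n ω (lam n) =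
          oracle (X n) (supp (βs n)) (response (X n) (βs n) (ε n) ω)}) atTop (𝓝 1)) ∧
    -- (3)
    (∀ (C K : ℕ → ℝ) (κ v : ℝ) (lhat : (n : ℕ) → Ω n → ℝ),
      Tendsto p atTop atTop →
      (fun n => Real.log (p n)) =o[atTop] (fun n : ℕ => (n : ℝ) * τ n ^ 2 * lam n ^ 2) →
      -- the error variances are bounded away from zero
      0 < v → (∀ᶠ n in atTop, ∀ i, v ≤ variance (ε n i) (μ n)) →
      -- asymptotic identifiability
      0 < κ →
      (∀ᶠ n in atTop, ∀ A : Finset (Fin (p n)), ¬ supp (βs n) ⊆ A → (A.card : ℝ) ≤ K n →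
        κ ≤ (n : ℝ)⁻¹ * residualSq (X n) A (X n *ᵥ βs n)) →
      (∀ᶠ n in atTop, ((supp (βs n)).card : ℝ) < K n) →
      Tendsto C atTop atTop →
      (fun n => ((supp (βs n)).card : ℝ) * C n * Real.log (p n))
        =o[atTop] (fun n : ℕ => (n : ℝ)) →
      (fun n : ℕ => K n ^ 2 * Real.log (p n) * Real.log n) =o[atTop] (fun n : ℕ => (n : ℝ)) →
      -- lhat minimizes the HBIC over the admissible tuning parameters whenever a minimizer exists
      (∀ n ω,
        (∃ l, IsHBICMin (X n) (response (X n) (βs n) (ε n) ω) (C n) (K n) (βhat n ω) l) →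
        IsHBICMin (X n) (response (X n) (βs n) (ε n) ω) (C n) (K n) (βhat n ω) (lhat n ω)) →
      Tendsto (fun n => prob (μ n) {ω | supp (βhat n ω (lhat n ω)) = supp (βs n)})
        atTop (𝓝 1)) ∧
    -- minimal signal requirement: some admissible tuning parameter succeeds as soon as the
    -- minimal signal dominates √(log p / n) / τ
    ((∀ᶠ n in atTop, 2 ≤ p n) →
      (fun n : ℕ => √(Real.log (p n) / n) / τ n) =o[atTop] (fun n => minSignal (βs n)) →
      ∃ lam' : ℕ → ℝ, (∀ n, 0 < lam' n) ∧ lam' =o[atTop] (fun n => minSignal (βs n)) ∧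
        (fun n : ℕ => √(Real.log (p n) / n) / τ n) =o[atTop] lam' ∧
        Tendsto (fun n => prob (μ n) {ω | βhat n ω (lam' n) =
          oracle (X n) (supp (βs n)) (response (X n) (βs n) (ε n) ω)}) atTop (𝓝 1)) := by
  have hX : ∀ᶠ n in atTop,
      SparseDesign (X n) (supp (βs n)) (⌊α⌋₊ - 1) κmin ηmin ηmax := by
    filter_upwards [hA₀, hstd, hA4min, hA4max, hA6max, hA6min] with n h1 h2 h3 h4 h5 h6
    exact sparseDesign_of_assumptions h1 h2 hα hκmin h3 h4 h5 h6
  refine ⟨eventually_prob_eq_oracle_ge hX hA2 hA3 hτ hA5τ hpath hlam hA5lam,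
    fun hu hlog => tendsto_prob_eq_oracle hσ hX hA2 hA3 hτ hA5τ hpath hlam hA5lam hu hlog,
    fun C K κ v lhat hp hlog hv hvar hκ hident hK hC hqC hK2 hlhat =>
      tendsto_prob_supp_eq hσ hX hA2 hA3 hτ hA5τ hpath hlam hA5lam hp hlog hv hvar hκ hident hK hC
        hqC hK2 hlhat,
    fun hp hd => exists_tuning_sequence hσ hX hA2 hA3 hτ hA5τ hpath hp hd⟩
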